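/- A (nondeterministic) one-counter automaton is a tuple $\mathcal{A} = (Q, q_I, \delta, F)$ with a finite set $Q$ of states, an initial state $q_I \in Q$, a set $F \subseteq Q$ of accepting states and a transition relation $\delta \subseteq Q \times \{\mathtt{inc}, \mathtt{dec}, \mathtt{ifzero}\} \times Q$. Its configurations are the pairs in $Q \times \mathbb{N}$, and $(q,n) \to (q',n')$ holds iff $(q,\mathtt{inc},q') \in \delta$ and $n' = n+1$, or $(q,\mathtt{dec},q') \in \delta$ and $n' = n-1 \ge 0$, or $(q,\mathtt{ifzero},q') \in \delta$ and $n = n' = 0$. A finite accepting run is a finite sequence $(q_0,n_0) \to \cdots \to (q_k,n_k)$ with $k \ge 0$, $(q_0,n_0) = (q_I,0)$ and $q_k \in F$. Formulae of LTL with registers (freeze LTL) over the alphabet $Q$ are built from letters $a \in Q$ and atoms $\uparrow_r$ (with $r \ge 1$) by $\neg$, $\wedge$, the temporal operators $\mathtt{X}$, $\mathtt{U}$ and $\mathtt{F}$ (where $\mathtt{F}\varphi$ means $\top\mathtt{U}\varphi$), and the freeze quantifiers $\downarrow_r$. They are interpreted at the positions of a finite run: $a$ holds at position $i$ iff $q_i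 = a$; $\downarrow_r \varphi$ stores the current position in register $r$ and continues with $\varphi$; $\uparrow_r$ holds at $i$ iff register $r$ holds a position $j$ with $n_j = n_i$ (it is false if the register is undefined); $\mathtt{X}\varphi$ holds at $i$ iff $i$ is not the last position and $\varphi$ holds at $i+1$; $\varphi\,\mathtt{U}\,\psi$ holds at $i$ iff $\psi$ holds at some position $j \ge i$ of the run and $\varphi$ holds at all positions $j'$ with $i \le j' < j$. A sentence is a formula in which every $\uparrow_r$ is in the scope of some $\downarrow_r$. The finitary existential model-checking problem is: given a one-counter automaton $\mathcal{A} = (Q, q_I, \delta, F)$ and a sentence $\varphi$ of LTL with registers over $Q$, is there a finite accepting run of $\mathcal{A}$ that satisfies $\varphi$ at position $0$, all registers being initially undefined? Theorem. The finitary existential model-checking problem is $\Sigma^0_1$-complete (under computable many-one reductions). It is $\Sigma^0_1$-complete already when restricted to sentences in which no register other than $1$ and no temporal operator other than $\mathtt{X}$ and $\mathtt{F}$ occurs. -/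

import Mathlib

namespace FreezeMC

/-! ### One-counter automata -/

/-- The instruction set of one-counter automata. -/
inductive Instr : Type
  | inc
  | dec
  | ifzero
  deriving DecidableEq

/-- Numbering of the three instructions. -/
def Instr.equivFin : Instr ≃ Fin 3 where
  toFun
    | .inc => 0
    | .dec => 1
    | .ifzero => 2
  invFun
    | 0 => .inc
    | 1 => .dec
    | 2 => .ifzero
  left_inv i := by cases i <;> rfl
  right_inv k := by fin_cases k <;> rfl

instance : Primcodable Instr := Primcodable.ofEquiv (Fin 3) Instr.equivFin

/-- The data `(Q, q_I, δ, F)` of a (nondeterministic) one-counter automaton. As it is the input of a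
decision problem, states are named by natural numbers and the finite sets `Q`, `δ`, `F` are given by
lists (only membership matters). -/
structure OneCounterAutomaton : Type where
  /-- the finite set `Q` of states -/
  states : List ℕ
  /-- the initial state `q_I` -/
  init : ℕ
  /-- the transition relation `δ` -/
  trans : List (ℕ × Instr × ℕ)
  /-- the set `F` of accepting states -/
  accept : List ℕ

namespace OneCounterAutomaton

/-- An automaton is the same thing as a tuple. -/
def equivTuple : OneCounterAutomaton ≃ List ℕ × ℕ × List (ℕ × Instr × ℕ) × List ℕ where
  toFun A := (A.states, A.init, A.trans, A.accept)
  invFun t := ⟨t.1, t.2.1, t.2.2.1, t.2.2.2⟩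
  left_inv _ := rfl
  right_inv _ := rfl

instance : Primcodable OneCounterAutomaton := Primcodable.ofEquiv _ equivTuple

/-- `q_I ∈ Q`, `δ ⊆ Q × L × Q` and `F ⊆ Q`. -/
def WellFormed (A : OneCounterAutomaton) : Prop :=
  A.init ∈ A.states ∧
    (∀ t ∈ A.trans, t.1 ∈ A.states ∧ t.2.2 ∈ A.states) ∧
    ∀ q ∈ A.accept, q ∈ A.states

/-- The one-step relation on configurations (state, counter value). -/
def Step (A : OneCounterAutomaton) (c c' : ℕ × ℕ) : Prop :=
  ((c.1, Instr.inc, c'.1) ∈ A.trans ∧ c'.2 = c.2 + 1) ∨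
  ((c.1, Instr.dec, c'.1) ∈ A.trans ∧ c.2 = c'.2 + 1) ∨
  ((c.1, Instr.ifzero, c'.1) ∈ A.trans ∧ c.2 = 0 ∧ c'.2 = 0)

/-- A finite run: a nonempty finite sequence of configurations that starts in the initial
configuration `(q_I, 0)` and is linked by the one-step relation. -/
structure FiniteRun (A : OneCounterAutomaton) : Type where
  /-- the number of steps -/
  steps : ℕ
  /-- the sequence of configurations -/
  config : Fin (steps + 1) → ℕ × ℕ
  start : config 0 = (A.init, 0)
  step : ∀ i : Fin steps, A.Step (config i.castSucc) (config i.succ)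

/-- A finite run is accepting if its last state is accepting. -/
def FiniteRun.Accepting {A : OneCounterAutomaton} (ρ : A.FiniteRun) : Prop :=
  (ρ.config (Fin.last ρ.steps)).1 ∈ A.accept

end OneCounterAutomaton

/-! ### LTL with registers over finite data words -/

/-- The temporal operators `X`, `U`, `F`. -/
inductive TemporalOp : Type
  | X
  | U
  | F
  deriving DecidableEq

/-- Formulae of LTL with registers (freeze LTL) over the alphabet `Γ`; the registers are the positive
integers. The operator `F` is a constructor of its own, so that fragments without `U` can be
singled out; its semantics is that of `⊤ U φ`, see `FiniteDataWord.sat_F_iff`. -/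
inductive Formula (Γ : Type) : Type
  /-- the current letter is `a` -/
  | letter (a : Γ)
  /-- `↑_r` -/
  | reg (r : ℕ+)
  /-- `¬ φ` -/
  | neg (φ : Formula Γ)
  /-- `φ ∧ ψ` -/
  | and (φ ψ : Formula Γ)
  /-- `X φ` -/
  | X (φ : Formula Γ)
  /-- `φ U ψ` -/
  | U (φ ψ : Formula Γ)
  /-- `F φ` -/
  | F (φ : Formula Γ)
  /-- `↓_r φ` -/
  | freeze (r : ℕ+) (φ : Formula Γ)

namespace Formula

/-- The letters that occur in a formula. -/
def letters {Γ : Type} : Formula Γ → Set Γ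
  | letter a => {a}
  | reg _ => ∅
  | neg φ => φ.letters
  | and φ ψ => φ.letters ∪ ψ.letters
  | X φ => φ.letters
  | U φ ψ => φ.letters ∪ ψ.letters
  | F φ => φ.letters
  | freeze _ φ => φ.letters

/-- The registers that occur in a formula, in some `↑_r` or in some `↓_r`. -/
def registers {Γ : Type} : Formula Γ → Finset ℕ+
  | letter _ => ∅
  | reg r => {r}
  | neg φ => φ.registers
  | and φ ψ => φ.registers ∪ ψ.registers
  | X φ => φ.registers
  | U φ ψ => φ.registers ∪ ψ.registers
  | F φ => φ.registers
  | freeze r φ => insert r φ.registers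

/-- The registers `r` for which `↑_r` has a free occurrence. -/
def freeRegisters {Γ : Type} : Formula Γ → Finset ℕ+
  | letter _ => ∅
  | reg r => {r}
  | neg φ => φ.freeRegisters
  | and φ ψ => φ.freeRegisters ∪ ψ.freeRegisters
  | X φ => φ.freeRegisters
  | U φ ψ => φ.freeRegisters ∪ ψ.freeRegisters
  | F φ => φ.freeRegisters
  | freeze r φ => φ.freeRegisters.erase r

/-- A sentence has no free occurrence of any `↑_r`. -/
def IsSentence {Γ : Type} (φ : Formula Γ) : Prop := φ.freeRegisters = ∅

/-- The temporal operators that occur in a formula. -/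
def temporalOps {Γ : Type} : Formula Γ → Finset TemporalOp
  | letter _ => ∅
  | reg _ => ∅
  | neg φ => φ.temporalOps
  | and φ ψ => φ.temporalOps ∪ ψ.temporalOps
  | X φ => insert TemporalOp.X φ.temporalOps
  | U φ ψ => insert TemporalOp.U (φ.temporalOps ∪ ψ.temporalOps)
  | F φ => insert TemporalOp.F φ.temporalOps
  | freeze _ φ => φ.temporalOps

/-! Gödel numbering of the formulae over the alphabet `ℕ`. -/

/-- The code of a formula: the head constructor modulo 8, and paired codes of its arguments. -/
def toCode : Formula ℕ → ℕ
  | letter a => 8 * a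
  | reg r => 8 * r.natPred + 1
  | neg φ => 8 * φ.toCode + 2
  | and φ ψ => 8 * Nat.pair φ.toCode ψ.toCode + 3
  | X φ => 8 * φ.toCode + 4
  | U φ ψ => 8 * Nat.pair φ.toCode ψ.toCode + 5
  | F φ => 8 * φ.toCode + 6
  | freeze r φ => 8 * Nat.pair r.natPred φ.toCode + 7

/-- The formula with a given code. -/
def ofCode (n : ℕ) : Formula ℕ :=
  match h : n % 8 with
  | 1 => reg (n / 8).succPNat
  | 2 => neg (ofCode (n / 8))
  | 3 => and (ofCode (n / 8).unpair.1) (ofCode (n / 8).unpair.2)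
  | 4 => X (ofCode (n / 8))
  | 5 => U (ofCode (n / 8).unpair.1) (ofCode (n / 8).unpair.2)
  | 6 => F (ofCode (n / 8))
  | 7 => freeze (n / 8).unpair.1.succPNat (ofCode (n / 8).unpair.2)
  | _ => letter (n / 8)
termination_by n
decreasing_by
  all_goals
    have h1 := Nat.unpair_left_le (n / 8)
    have h2 := Nat.unpair_right_le (n / 8)
    omega

theorem ofCode_toCode (φ : Formula ℕ) : ofCode φ.toCode = φ := by
  induction φ <;> rw [toCode, ofCode] <;> split <;> first | omega | skip
  all_goals
    simp_all [Nat.mul_add_div]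

theorem toCode_ofCode (n : ℕ) : (ofCode n).toCode = n := by
  induction n using Nat.strong_induction_on with
  | _ n ih =>
    have h1 := Nat.unpair_left_le (n / 8)
    have h2 := Nat.unpair_right_le (n / 8)
    rw [ofCode]
    split <;> simp only [toCode, Nat.natPred_succPNat]
    · omega
    · rw [ih _ (by omega)]; omega
    · rw [ih _ (by omega), ih _ (by omega), Nat.pair_unpair]; omega
    · rw [ih _ (by omega)]; omega
    · rw [ih _ (by omega), ih _ (by omega), Nat.pair_unpair]; omega
    · rw [ih _ (by omega)]; omega
    · rw [ih _ (by omega), Nat.pair_unpair]; omega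
    · have := Nat.mod_lt n (show 0 < 8 by norm_num)
      grind

/-- The Gödel numbering as a bijection. -/
def equivNat : Formula ℕ ≃ ℕ where
  toFun := toCode
  invFun := ofCode
  left_inv := ofCode_toCode
  right_inv := toCode_ofCode

instance : Primcodable (Formula ℕ) := Primcodable.ofEquiv ℕ equivNat

end Formula

/-- A finite data word over the alphabet `Γ`: a nonempty finite word together with an equivalence
relation on its positions. -/
structure FiniteDataWord (Γ : Type) : Type where
  length : ℕ
  length_pos : 0 < length
  letter : Fin length → Γ
  sim : Setoid (Fin length)

namespace FiniteDataWord

/-- The satisfaction relation `σ, i ⊨_v φ`; a register valuation `v` is a partial map from registers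
to positions. -/
def Sat {Γ : Type} (σ : FiniteDataWord Γ) :
    (ℕ+ → Option (Fin σ.length)) → Fin σ.length → Formula Γ → Prop
  | _, i, .letter a => σ.letter i = a
  | v, i, .reg r => ∃ k, v r = some k ∧ σ.sim k i
  | v, i, .neg φ => ¬ σ.Sat v i φ
  | v, i, .and φ ψ => σ.Sat v i φ ∧ σ.Sat v i ψ
  | v, i, .X φ => ∃ h : (i : ℕ) + 1 < σ.length, σ.Sat v ⟨i + 1, h⟩ φ
  | v, i, .U φ ψ => ∃ j, i ≤ j ∧ σ.Sat v j ψ ∧ ∀ j', i ≤ j' → j' < j → σ.Sat v j' φ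
  | v, i, .F φ => ∃ j, i ≤ j ∧ σ.Sat v j φ
  | v, i, .freeze r φ => σ.Sat (Function.update v r (some i)) i φ

/-- `F φ` is equivalent to `⊤ U φ`, where `⊤` is any formula that holds everywhere. -/
theorem sat_F_iff {Γ : Type} (σ : FiniteDataWord Γ) (v : ℕ+ → Option (Fin σ.length))
    (i : Fin σ.length) (φ top : Formula Γ) (htop : ∀ j, σ.Sat v j top) :
    σ.Sat v i (.F φ) ↔ σ.Sat v i (.U top φ) := by
  simp [Sat, htop]

/-- The data word satisfies the sentence `φ` at its first position, the registers being initially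
undefined. -/
def Models {Γ : Type} (σ : FiniteDataWord Γ) (φ : Formula Γ) : Prop :=
  σ.Sat (fun _ => none) ⟨0, σ.length_pos⟩ φ

end FiniteDataWord

/-- A finite run as a data word over the set of states: two positions are equivalent iff they carry
the same counter value. -/
def OneCounterAutomaton.FiniteRun.toDataWord {A : OneCounterAutomaton} (ρ : A.FiniteRun) :
    FiniteDataWord ℕ where
  length := ρ.steps + 1
  length_pos := Nat.succ_pos _
  letter i := (ρ.config i).1
  sim := Setoid.ker fun i => (ρ.config i).2

/-! ### The decision problems -/

/-- `x = (A, φ)` is an instance of the model-checking problem: `A` is a one-counter automaton and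
`φ` is a sentence of LTL with registers over the alphabet of the states of `A`. -/
def IsInstance (x : OneCounterAutomaton × Formula ℕ) : Prop :=
  x.1.WellFormed ∧ x.2.IsSentence ∧ ∀ a ∈ x.2.letters, a ∈ x.1.states

/-- The finitary existential model-checking problem: some finite accepting run of `A`
satisfies `φ`. -/
def FinitaryMC (x : OneCounterAutomaton × Formula ℕ) : Prop :=
  IsInstance x ∧ ∃ ρ : x.1.FiniteRun, ρ.Accepting ∧ ρ.toDataWord.Models x.2

/-- The finitary existential model-checking problem restricted to formulae with registers in
`{1, …, n}` and temporal operators in `O`. -/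
def FinitaryMCRestricted (n : ℕ) (O : Finset TemporalOp)
    (x : OneCounterAutomaton × Formula ℕ) : Prop :=
  FinitaryMC x ∧ (∀ r ∈ x.2.registers, (r : ℕ) ≤ n) ∧ x.2.temporalOps ⊆ O

/-- `Σ⁰₁`-completeness: recursively enumerable, and every recursively enumerable set of natural
numbers is many-one reducible to it by a computable function. -/
def SigmaZeroOneComplete {α : Type} [Primcodable α] (p : α → Prop) : Prop :=
  REPred p ∧ ∀ q : ℕ → Prop, REPred q → ManyOneReducible q p

end FreezeMC

/-! Membership in Σ⁰₁ holds because a positive answer has a finite witness whose correctness is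
primitive recursive: a run, a list of judgments showing that the formula holds on it, and a list
showing that the formula is syntactically admissible (`rePred_modelChecking`). Both lists consist of
locally justified entries, so no recursion along formula codes has to be shown primitive recursive.

For hardness, an r.e. set is first turned into a finite graph whose edges act on finitely many
counters (`exists_graph_of_rePred`): primitive recursive functions are computed by nondeterministic
counter programs, and a program guesses a step bound and checks that a fixed partial recursive code
halts within it.

Such a graph is simulated by a single counter and a formula. The automaton first climbs to a top
value `N`, then moves its counter freely below `N` and executes each edge by visiting a mark state,
which names the operation and the target node, at a value of its choice. The simulated counter `c`
is the number of increment marks on `c` minus the number of decrement marks on `c`. The formula uses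
equality of data to keep this honest: increments of `c` are marked at pairwise different values, and
so are decrements; each decrement is matched with an earlier increment at the same value; and at a
zero test each earlier increment has been matched already.

With one register and only future operators, "an increment comes before this decrement" is not said
from the decrement. It is said from the position of the climb that carries the same value: if a
decrement at this value follows, then so does an increment with a decrement after it; as decrements
at one value are unique, it is the same decrement. The top value is forbidden to recur, so every
value used later was indeed met in the climb. The zero-test condition is likewise split in two: each
increment before the test is matched at some time, and never after the test.

Soundness (`IsFaithful.exists_execution`) compares numbers of marks by injecting them through their
values. Conversely (`exists_faithful_run`), an execution is encoded by marking the increments of `c`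
at the values 0, 1, 2, … in order, and the decrements likewise. The input `m` enters only as the
number of climbing positions in state 1, which count as increments of counter 0; the formula fixes
this number by iterated `X`. Hence the automaton of the reduction is constant and only the sentence
varies with `m`. -/

namespace FreezeMC
open Function

/-! ### Recursive enumerability -/

/-- Projections of primitive recursive relations are recursively enumerable. -/
theorem rePred_exists {α β : Type} [Primcodable α] [Primcodable β] {P : α → β → Prop}
    (hP : PrimrecRel P) : REPred fun a => ∃ w, P a w := by
  classical
  have hf : Computable₂ fun (a : α) (k : ℕ) =>
      (Encodable.decode (α := β) k).bind fun w => if P a w then some () else none := by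
    refine Primrec.to_comp ?_
    refine Primrec.option_bind (Primrec.decode.comp Primrec.snd) ?_
    exact Primrec.ite (hP.comp (Primrec.fst.comp Primrec.fst) Primrec.snd)
      (Primrec.const _) (Primrec.const _)
  refine (Partrec.dom_re (Partrec.rfindOpt hf)).of_eq fun a => ?_
  rw [Nat.rfindOpt_dom]
  constructor
  · rintro ⟨k, u, h⟩
    simp only [Option.mem_def, Option.bind_eq_some_iff] at h
    obtain ⟨w, -, hw⟩ := h
    by_cases hp : P a w
    · exact ⟨w, hp⟩
    · simp [hp] at hw
  · rintro ⟨w, hw⟩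
    exact ⟨Encodable.encode w, (), by simp [hw]⟩

theorem primrecRel_mem {α : Type} [Primcodable α] : PrimrecRel fun (a : α) (l : List α) => a ∈ l :=
  ((Primrec.eq (α := α)).exists_mem_list.comp Primrec.snd Primrec.fst).of_eq fun p => by simp

/-! ### Certificates for satisfaction of a formula -/

/-- A valuation, given as the finite list of pairs (register, stored counter value). -/
abbrev ValuationList := List (ℕ × ℕ)

/-- Store `x` in the register `r`. -/
def ValuationList.update (v : ValuationList) (r x : ℕ) : ValuationList :=
  (r, x) :: v.filter fun p => p.1 ≠ r

/-- A judgment `((v, i), c, b)` says that the formula with code `c` has the truth value `b` at position `i`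
under the valuation `v`. -/
abbrev Judgment := (ValuationList × ℕ) × ℕ × Bool

/-- The judgment `j` about the word `run` follows from judgments in `D`. -/
def Justified (run : List (ℕ × ℕ)) (D : List Judgment) (j : Judgment) : Prop :=
  (j.2.1 % 8 = 0 ∧ (j.2.2 = true ↔ (run.getD j.1.2 (0, 0)).1 = j.2.1 / 8)) ∨
  (j.2.1 % 8 = 1 ∧ (j.2.2 = true ↔ (j.2.1 / 8, (run.getD j.1.2 (0, 0)).2) ∈ j.1.1)) ∨
  (j.2.1 % 8 = 2 ∧ (j.1, j.2.1 / 8, !j.2.2) ∈ D) ∨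
  (j.2.1 % 8 = 3 ∧
    ((j.2.2 = true ∧ (j.1, (j.2.1 / 8).unpair.1, true) ∈ D ∧ (j.1, (j.2.1 / 8).unpair.2, true) ∈ D) ∨
    (j.2.2 = false ∧
      ((j.1, (j.2.1 / 8).unpair.1, false) ∈ D ∨ (j.1, (j.2.1 / 8).unpair.2, false) ∈ D)))) ∨
  (j.2.1 % 8 = 4 ∧ ((j.1.2 + 1 < run.length ∧ ((j.1.1, j.1.2 + 1), j.2.1 / 8, j.2.2) ∈ D) ∨
    (¬ j.1.2 + 1 < run.length ∧ j.2.2 = false))) ∨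
  (j.2.1 % 8 = 5 ∧
    ((j.2.2 = true ∧ ((j.1, (j.2.1 / 8).unpair.2, true) ∈ D ∨
      ((j.1, (j.2.1 / 8).unpair.1, true) ∈ D ∧ j.1.2 + 1 < run.length ∧
        ((j.1.1, j.1.2 + 1), j.2.1, true) ∈ D))) ∨
    (j.2.2 = false ∧ (j.1, (j.2.1 / 8).unpair.2, false) ∈ D ∧
      ((j.1, (j.2.1 / 8).unpair.1, false) ∈ D ∨ ¬ j.1.2 + 1 < run.length ∨
        ((j.1.1, j.1.2 + 1), j.2.1, false) ∈ D)))) ∨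
  (j.2.1 % 8 = 6 ∧
    ((j.2.2 = true ∧ ((j.1, j.2.1 / 8, true) ∈ D ∨
      (j.1.2 + 1 < run.length ∧ ((j.1.1, j.1.2 + 1), j.2.1, true) ∈ D))) ∨
    (j.2.2 = false ∧ (j.1, j.2.1 / 8, false) ∈ D ∧
      (¬ j.1.2 + 1 < run.length ∨ ((j.1.1, j.1.2 + 1), j.2.1, false) ∈ D)))) ∨
  (j.2.1 % 8 = 7 ∧
    ((j.1.1.update (j.2.1 / 8).unpair.1 (run.getD j.1.2 (0, 0)).2, j.1.2),
      (j.2.1 / 8).unpair.2, j.2.2) ∈ D)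

theorem primrec_update : Primrec fun p : ValuationList × ℕ × ℕ => p.1.update p.2.1 p.2.2 := by
  have hR : PrimrecRel fun (a : ℕ × ℕ) (r : ℕ) => a.1 ≠ r :=
    (Primrec.eq.comp (Primrec.fst.comp Primrec.fst) Primrec.snd).not
  have h1 := hR.listFilter.comp (Primrec.fst (α := ValuationList) (β := ℕ × ℕ))
    (Primrec.fst.comp Primrec.snd)
  exact Primrec.list_cons.comp Primrec.snd h1

/-- Justification only inspects the head constructor of one code and membership in given lists, so
it is a Boolean combination of primitive recursive tests. -/
theorem primrecPred_justified :
    PrimrecPred fun p : (List (ℕ × ℕ) × List Judgment) × Judgment => Justified p.1.1 p.1.2 p.2 := by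
  let T := (List (ℕ × ℕ) × List Judgment) × Judgment
  have run : Primrec fun p : T => p.1.1 := Primrec.fst.comp Primrec.fst
  have D : Primrec fun p : T => p.1.2 := Primrec.snd.comp Primrec.fst
  have v : Primrec fun p : T => p.2.1.1 := Primrec.fst.comp (Primrec.fst.comp Primrec.snd)
  have vi : Primrec fun p : T => p.2.1 := Primrec.fst.comp Primrec.snd
  have i : Primrec fun p : T => p.2.1.2 := Primrec.snd.comp (Primrec.fst.comp Primrec.snd)
  have c : Primrec fun p : T => p.2.2.1 := Primrec.fst.comp (Primrec.snd.comp Primrec.snd)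
  have b : Primrec fun p : T => p.2.2.2 := Primrec.snd.comp (Primrec.snd.comp Primrec.snd)
  have k : Primrec fun p : T => p.2.2.1 / 8 := Primrec.nat_div.comp c (Primrec.const 8)
  have k1 : Primrec fun p : T => (p.2.2.1 / 8).unpair.1 := Primrec.fst.comp (Primrec.unpair.comp k)
  have k2 : Primrec fun p : T => (p.2.2.1 / 8).unpair.2 := Primrec.snd.comp (Primrec.unpair.comp k)
  have m (a : ℕ) : PrimrecPred fun p : T => p.2.2.1 % 8 = a :=
    Primrec.eq.comp (Primrec.nat_mod.comp c (Primrec.const 8)) (Primrec.const a)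
  have i1 : Primrec fun p : T => p.2.1.2 + 1 := Primrec.succ.comp i
  have vi1 : Primrec fun p : T => (p.2.1.1, p.2.1.2 + 1) := v.pair i1
  have lt : PrimrecPred fun p : T => p.2.1.2 + 1 < p.1.1.length :=
    Primrec.nat_lt.comp i1 (Primrec.list_length.comp run)
  have cf : Primrec fun p : T => p.1.1.getD p.2.1.2 (0, 0) := (Primrec.list_getD _).comp run i
  have tt : Primrec fun _ : T => true := Primrec.const _
  have ff : Primrec fun _ : T => false := Primrec.const _
  have bt : PrimrecPred fun p : T => p.2.2.2 = true := Primrec.eq.comp b tt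
  have bf : PrimrecPred fun p : T => p.2.2.2 = false := Primrec.eq.comp b ff
  have mem {f : T → ValuationList × ℕ} {g : T → ℕ} {h : T → Bool} (hf : Primrec f) (hg : Primrec g)
      (hh : Primrec h) : PrimrecPred fun p => (f p, g p, h p) ∈ p.1.2 :=
    primrecRel_mem.comp (hf.pair (hg.pair hh)) D
  have iff {p q : T → Prop} (hp : PrimrecPred p) (hq : PrimrecPred q) :
      PrimrecPred fun a => p a ↔ q a :=
    ((hp.and hq).or (hp.not.and hq.not)).of_eq fun a => by tauto
  have upd : Primrec fun p : T =>
      (p.2.1.1.update (p.2.2.1 / 8).unpair.1 (p.1.1.getD p.2.1.2 (0, 0)).2, p.2.1.2) :=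
    (primrec_update.comp (v.pair (k1.pair (Primrec.snd.comp cf)))).pair i
  unfold Justified
  refine .or (.and (m 0) (iff bt (Primrec.eq.comp (Primrec.fst.comp cf) k))) ?_
  refine .or (.and (m 1) (iff bt (primrecRel_mem.comp (k.pair (Primrec.snd.comp cf)) v))) ?_
  refine .or (.and (m 2) (mem vi k (Primrec.not.comp b))) ?_
  refine .or (.and (m 3) (.or (bt.and ((mem vi k1 tt).and (mem vi k2 tt)))
    (bf.and ((mem vi k1 ff).or (mem vi k2 ff))))) ?_
  refine .or (.and (m 4) (.or (lt.and (mem vi1 k b)) (lt.not.and bf))) ?_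
  refine .or (.and (m 5) (.or (bt.and ((mem vi k2 tt).or ((mem vi k1 tt).and
    (lt.and (mem vi1 c tt))))) (bf.and ((mem vi k2 ff).and
      ((mem vi k1 ff).or (lt.not.or (mem vi1 c ff))))))) ?_
  refine .or (.and (m 6) (.or (bt.and ((mem vi k tt).or (lt.and (mem vi1 c tt))))
    (bf.and ((mem vi k ff).and (lt.not.or (mem vi1 c ff)))))) ?_
  exact .and (m 7) (mem upd k2 b)

/-- Falsity is certified by judgments with value `false`, not by the absence of judgments; so every
clause is positive in `D`. This is what allows certificates to be merged. -/
theorem Justified.mono {run : List (ℕ × ℕ)} {D D' : List Judgment} (h : D ⊆ D') {j : Judgment}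
    (hj : Justified run D j) : Justified run D' j := by
  unfold Justified at *
  have h' : ∀ x, x ∈ D → x ∈ D' := fun x hx => h hx
  generalize (j.2.1 / 8).unpair = u at *
  rcases hj with hj | hj | hj | hj | hj | hj | hj | hj
  · exact .inl hj
  · exact .inr (.inl hj)
  · exact .inr (.inr (.inl ⟨hj.1, h' _ hj.2⟩))
  · refine .inr (.inr (.inr (.inl ⟨hj.1, ?_⟩)))
    have := hj.2
    tauto
  · refine .inr (.inr (.inr (.inr (.inl ⟨hj.1, ?_⟩))))
    have := hj.2
    tauto
  · refine .inr (.inr (.inr (.inr (.inr (.inl ⟨hj.1, ?_⟩)))))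
    have := hj.2
    tauto
  · refine .inr (.inr (.inr (.inr (.inr (.inr (.inl ⟨hj.1, ?_⟩))))))
    have := hj.2
    tauto
  · exact .inr (.inr (.inr (.inr (.inr (.inr (.inr ⟨hj.1, h' _ hj.2⟩))))))

/-- The judgment belongs to a finite set of judgments that justify each other. -/
def HasCertificate (run : List (ℕ × ℕ)) (j : Judgment) : Prop :=
  ∃ D, (∀ j' ∈ D, Justified run D j') ∧ j ∈ D

/-- By monotonicity the certificates of the finitely many premises can be concatenated, and `j` is
put on top. -/
theorem HasCertificate.of_justified {run : List (ℕ × ℕ)} {j : Judgment} (D : List Judgment)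
    (hD : ∀ j' ∈ D, HasCertificate run j') (hj : Justified run D j) : HasCertificate run j := by
  have key : ∀ D : List Judgment, (∀ j' ∈ D, HasCertificate run j') →
      ∃ D', (∀ j' ∈ D', Justified run D' j') ∧ D ⊆ D' := by
    intro D
    induction D with
    | nil => exact fun _ => ⟨[], by simp, by simp⟩
    | cons a D ih =>
      intro h
      obtain ⟨D₁, h1, h2⟩ := ih fun j hj => h j (List.mem_cons_of_mem _ hj)
      obtain ⟨D₂, h3, h4⟩ := h a List.mem_cons_self
      refine ⟨D₂ ++ D₁, ?_, ?_⟩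
      · intro j' hj'
        rcases List.mem_append.1 hj' with hj' | hj'
        · exact (h3 j' hj').mono (List.subset_append_left _ _)
        · exact (h1 j' hj').mono (List.subset_append_right _ _)
      · exact List.cons_subset.2 ⟨List.mem_append_left _ h4, fun x hx =>
          List.mem_append_right _ (h2 hx)⟩
  obtain ⟨D', h1, h2⟩ := key D hD
  refine ⟨j :: D', ?_, List.mem_cons_self⟩
  intro j' hj'
  rcases List.mem_cons.1 hj' with rfl | hj'
  · exact hj.mono fun x hx => List.mem_cons_of_mem _ (h2 hx)
  · exact (h1 j' hj').mono (List.subset_cons_self _ _)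

/-- The list `run` of pairs (letter, datum) is a concrete representation of the data word `σ`. -/
structure Represents (run : List (ℕ × ℕ)) (σ : FiniteDataWord ℕ) : Prop where
  length_eq : run.length = σ.length
  letter_eq : ∀ i : Fin σ.length, σ.letter i = (run.getD i (0, 0)).1
  sim_iff : ∀ i j : Fin σ.length, σ.sim i j ↔ (run.getD i (0, 0)).2 = (run.getD j (0, 0)).2

/-- The list `v` describes the register valuation `w`. -/
def ValuationList.Describes (v : ValuationList) (run : List (ℕ × ℕ)) {n : ℕ}
    (w : ℕ+ → Option (Fin n)) : Prop :=
  ∀ r x, (r, x) ∈ v ↔ ∃ k, w r.succPNat = some k ∧ (run.getD k (0, 0)).2 = x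

/-- Entries of a register are erased before the new one is stored; a stale entry would make `↑_r`
true at an old value. Register `r` is listed as `r.natPred`. -/
theorem ValuationList.Describes.update {v : ValuationList} {run : List (ℕ × ℕ)} {n : ℕ}
    {w : ℕ+ → Option (Fin n)} (h : v.Describes run w) (r : ℕ+) (i : Fin n) :
    (v.update r.natPred (run.getD i (0, 0)).2).Describes run (Function.update w r (some i)) := by
  intro r' x
  by_cases hr : r' = r.natPred
  · subst hr
    simp [ValuationList.update, eq_comm]
  · have hr' : r'.succPNat ≠ r := by
      rintro rfl
      simp at hr
    simp [ValuationList.update, hr, hr', h r' x]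

theorem code_div (k a : ℕ) (h : a < 8) : (8 * k + a) / 8 = k := by omega

theorem code_mod (k a : ℕ) (h : a < 8) : (8 * k + a) % 8 = a := by omega

namespace FiniteDataWord
variable {Γ : Type} (σ : FiniteDataWord Γ) (w : ℕ+ → Option (Fin σ.length)) (i : Fin σ.length)
  (φ ψ : Formula Γ)

theorem sat_U_unfold : σ.Sat w i (.U φ ψ) ↔
    σ.Sat w i ψ ∨ (σ.Sat w i φ ∧ ∃ h : (i : ℕ) + 1 < σ.length, σ.Sat w ⟨i + 1, h⟩ (.U φ ψ)) := by
  constructor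
  · rintro ⟨j, hij, hj, hall⟩
    rcases eq_or_lt_of_le hij with rfl | hlt
    · exact .inl hj
    · have h : (i : ℕ) + 1 < σ.length := lt_of_le_of_lt (Nat.succ_le_of_lt hlt) j.2
      refine .inr ⟨hall i le_rfl hlt, h, j, Nat.succ_le_of_lt hlt, hj, fun j' h1 h2 => ?_⟩
      exact hall j' (le_trans (Nat.le_succ i) h1) h2
  · rintro (h | ⟨h, hlt, j, hij, hj, hall⟩)
    · exact ⟨i, le_rfl, h, fun j' h1 h2 => absurd h1 (not_le_of_gt h2)⟩
    · refine ⟨j, le_trans (Nat.le_succ i) hij, hj, fun j' h1 h2 => ?_⟩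
      rcases eq_or_lt_of_le h1 with rfl | hlt'
      · exact h
      · exact hall j' (Nat.succ_le_of_lt hlt') h2

theorem sat_F_unfold : σ.Sat w i (.F φ) ↔
    σ.Sat w i φ ∨ ∃ h : (i : ℕ) + 1 < σ.length, σ.Sat w ⟨i + 1, h⟩ (.F φ) := by
  constructor
  · rintro ⟨j, hij, hj⟩
    rcases eq_or_lt_of_le hij with rfl | hlt
    · exact .inl hj
    · exact .inr ⟨lt_of_le_of_lt (Nat.succ_le_of_lt hlt) j.2, j, Nat.succ_le_of_lt hlt, hj⟩
  · rintro (h | ⟨hlt, j, hij, hj⟩)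
    · exact ⟨i, le_rfl, h⟩
    · exact ⟨j, le_trans (Nat.le_succ i) hij, hj⟩

end FiniteDataWord

/-- Mutual justification cannot be circular: each premise concerns a proper subformula, or the same
`U` or `F` formula one position further on. Hence the induction on formulae, with an inner one on
the distance to the end of the word. -/
theorem Justified.sound {run : List (ℕ × ℕ)} {σ : FiniteDataWord ℕ} (hσ : Represents run σ)
    {D : List Judgment} (hD : ∀ j ∈ D, Justified run D j) (φ : Formula ℕ) :
    ∀ (v : ValuationList) (w : ℕ+ → Option (Fin σ.length)) (i : Fin σ.length) (b : Bool),
      v.Describes run w → ((v, (i : ℕ)), φ.toCode, b) ∈ D → (b = true ↔ σ.Sat w i φ) := by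
  have cut (P : Fin σ.length → Prop) (i : Fin σ.length) (ih : ∀ j, i < j → P j) :
      ∀ h : (i : ℕ) + 1 < σ.length, P ⟨i + 1, h⟩ := fun h => ih _ (Nat.lt_succ_self i)
  induction φ with
  | letter a =>
    intro v w i b hv hmem
    have := hD _ hmem
    have h0 := code_div a 0 (by omega)
    have h1 := code_mod a 0 (by omega)
    simp only [add_zero] at h0 h1
    simp only [Justified, Formula.toCode, h0, h1] at this
    simpa [FiniteDataWord.Sat, hσ.letter_eq] using this
  | reg r =>
    intro v w i b hv hmem
    have := hD _ hmem
    simp only [Justified, Formula.toCode, code_div _ 1 (by omega), code_mod _ 1 (by omega)] at this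
    rw [hv] at this
    simpa [FiniteDataWord.Sat, hσ.sim_iff] using this
  | neg φ ih =>
    intro v w i b hv hmem
    have := hD _ hmem
    simp only [Justified, Formula.toCode, code_div _ 2 (by omega), code_mod _ 2 (by omega)] at this
    simp only [OfNat.ofNat_ne_zero, false_and, OfNat.ofNat_ne_one, true_and, Nat.reduceEqDiff,
      or_false, false_or] at this
    have := ih v w i _ hv this
    rw [FiniteDataWord.Sat, ← this]
    cases b <;> simp
  | and φ ψ ih1 ih2 =>
    intro v w i b hv hmem
    have := hD _ hmem
    simp only [Justified, Formula.toCode, code_div _ 3 (by omega), code_mod _ 3 (by omega),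
      Nat.unpair_pair] at this
    simp only [OfNat.ofNat_ne_zero, false_and, OfNat.ofNat_ne_one, true_and, Nat.reduceEqDiff,
      or_false, false_or] at this
    have e1 := fun b => ih1 v w i b hv
    have e2 := fun b => ih2 v w i b hv
    rw [FiniteDataWord.Sat]
    rcases this with ⟨rfl, h1, h2⟩ | ⟨rfl, h1 | h1⟩
    · have := e1 _ h1
      have := e2 _ h2
      tauto
    · have := e1 _ h1
      simp_all
    · have := e2 _ h1
      simp_all
  | X φ ih =>
    intro v w i b hv hmem
    have := hD _ hmem
    simp only [Justified, Formula.toCode, code_div _ 4 (by omega), code_mod _ 4 (by omega)] at this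
    simp only [OfNat.ofNat_ne_zero, false_and, OfNat.ofNat_ne_one, true_and, Nat.reduceEqDiff,
      or_false, false_or, hσ.length_eq] at this
    rw [FiniteDataWord.Sat]
    rcases this with ⟨h, h1⟩ | ⟨h, rfl⟩
    · have := ih v w ⟨i + 1, h⟩ b hv h1
      rw [this]
      exact ⟨fun h' => ⟨h, h'⟩, fun ⟨_, h'⟩ => h'⟩
    · simp [h]
  | U φ ψ ih1 ih2 =>
    intro v w i b hv
    induction hn : σ.length - (i : ℕ) using Nat.strong_induction_on generalizing i b with
    | _ n ihn =>
    intro hmem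
    have := hD _ hmem
    rw [FiniteDataWord.sat_U_unfold]
    have e1 := fun b => ih1 v w i b hv
    have e2 := fun b => ih2 v w i b hv
    have e3 := fun b (h : (i : ℕ) + 1 < σ.length) => ihn (σ.length - (i + 1)) (by omega)
      ⟨i + 1, h⟩ b rfl
    simp only [Formula.toCode] at e3
    simp only [Justified, Formula.toCode, code_div _ 5 (by omega), code_mod _ 5 (by omega),
      Nat.unpair_pair] at this
    simp only [OfNat.ofNat_ne_zero, false_and, OfNat.ofNat_ne_one, true_and, Nat.reduceEqDiff,
      or_false, false_or, hσ.length_eq] at this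
    rcases this with ⟨rfl, h1 | ⟨h1, h2, h3⟩⟩ | ⟨rfl, h1, h2⟩
    · have := e2 _ h1
      simp_all
    · have a1 := e1 _ h1
      have a2 := e3 _ h2 h3
      simp_all
    · have a1 := e2 _ h1
      simp only [Bool.false_eq_true, false_iff] at a1
      rcases h2 with h2 | h2 | h2
      · have := e1 _ h2
        simp_all
      · simp_all
      · by_cases h : (i : ℕ) + 1 < σ.length
        · have := e3 _ h h2
          simp_all
        · simp_all
  | F φ ih1 =>
    intro v w i b hv
    induction hn : σ.length - (i : ℕ) using Nat.strong_induction_on generalizing i b with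
    | _ n ihn =>
    intro hmem
    have := hD _ hmem
    rw [FiniteDataWord.sat_F_unfold]
    have e1 := fun b => ih1 v w i b hv
    have e3 := fun b (h : (i : ℕ) + 1 < σ.length) => ihn (σ.length - (i + 1)) (by omega)
      ⟨i + 1, h⟩ b rfl
    simp only [Formula.toCode] at e3
    simp only [Justified, Formula.toCode, code_div _ 6 (by omega), code_mod _ 6 (by omega)] at this
    simp only [OfNat.ofNat_ne_zero, false_and, OfNat.ofNat_ne_one, true_and, Nat.reduceEqDiff,
      or_false, false_or, hσ.length_eq] at this
    rcases this with ⟨rfl, h1 | ⟨h2, h3⟩⟩ | ⟨rfl, h1, h2⟩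
    · have := e1 _ h1
      simp_all
    · have a2 := e3 _ h2 h3
      simp_all
    · have a1 := e1 _ h1
      simp only [Bool.false_eq_true, false_iff] at a1
      rcases h2 with h2 | h2
      · simp_all
      · by_cases h : (i : ℕ) + 1 < σ.length
        · have := e3 _ h h2
          simp_all
        · simp_all
  | freeze r φ ih =>
    intro v w i b hv hmem
    have := hD _ hmem
    simp only [Justified, Formula.toCode, code_div _ 7 (by omega), code_mod _ 7 (by omega),
      Nat.unpair_pair] at this
    simp only [OfNat.ofNat_ne_zero, false_and, OfNat.ofNat_ne_one, true_and, Nat.reduceEqDiff,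
      false_or] at this
    exact ih _ _ i b (hv.update r i) this

-- The same nested induction builds the certificates. It treats both truth values at once, because a
-- negation asks for the opposite value of its argument.
open Classical in
theorem Represents.hasCertificate {run : List (ℕ × ℕ)} {σ : FiniteDataWord ℕ} (hσ : Represents run σ)
    (φ : Formula ℕ) :
    ∀ (v : ValuationList) (w : ℕ+ → Option (Fin σ.length)) (i : Fin σ.length),
      v.Describes run w → HasCertificate run ((v, (i : ℕ)), φ.toCode, decide (σ.Sat w i φ)) := by
  induction φ with
  | letter a =>
    intro v w i hv
    have h0 := code_div a 0 (by omega)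
    have h1 := code_mod a 0 (by omega)
    simp only [add_zero] at h0 h1
    refine .of_justified [] (by simp) (.inl ⟨by simp [Formula.toCode], ?_⟩)
    simp [FiniteDataWord.Sat, hσ.letter_eq, Formula.toCode]
  | reg r =>
    intro v w i hv
    refine .of_justified [] (by simp) (.inr (.inl ⟨code_mod _ 1 (by omega), ?_⟩))
    simp only [Formula.toCode, code_div _ 1 (show 1 < 8 by omega), hv _ _]
    simp [FiniteDataWord.Sat, hσ.sim_iff]
  | neg φ ih =>
    intro v w i hv
    refine .of_justified [_] (List.forall_mem_singleton.2 (ih v w i hv))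
      (.inr (.inr (.inl ⟨code_mod _ 2 (by omega), ?_⟩)))
    by_cases h : σ.Sat w i φ <;> simp [FiniteDataWord.Sat, Formula.toCode, code_div, h]
  | and φ ψ ih1 ih2 =>
    intro v w i hv
    refine .of_justified [_, _] (List.forall_mem_cons.2 ⟨ih1 v w i hv,
      List.forall_mem_singleton.2 (ih2 v w i hv)⟩)
      (.inr (.inr (.inr (.inl ⟨code_mod _ 3 (by omega), ?_⟩))))
    simp only [Formula.toCode, code_div _ 3 (show 3 < 8 by omega), Nat.unpair_pair,
      FiniteDataWord.Sat]
    by_cases h1 : σ.Sat w i φ <;> by_cases h2 : σ.Sat w i ψ <;> simp [h1, h2]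
  | X φ ih =>
    intro v w i hv
    by_cases h : (i : ℕ) + 1 < σ.length
    · refine .of_justified [_] (List.forall_mem_singleton.2 (ih v w ⟨i + 1, h⟩ hv))
        (.inr (.inr (.inr (.inr (.inl ⟨code_mod _ 4 (by omega), .inl ⟨by rwa [hσ.length_eq], ?_⟩⟩)))))
      simp [Formula.toCode, code_div, FiniteDataWord.Sat, h]
    · refine .of_justified [] (by simp)
        (.inr (.inr (.inr (.inr (.inl ⟨code_mod _ 4 (by omega), .inr ⟨by rwa [hσ.length_eq], ?_⟩⟩)))))
      simp [FiniteDataWord.Sat, h]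
  | U φ ψ ih1 ih2 =>
    intro v w i hv
    induction hn : σ.length - (i : ℕ) using Nat.strong_induction_on generalizing i with
    | _ n ihn =>
    by_cases h : (i : ℕ) + 1 < σ.length
    · refine .of_justified [_, _, _] (List.forall_mem_cons.2 ⟨ih1 v w i hv,
        List.forall_mem_cons.2 ⟨ih2 v w i hv, List.forall_mem_singleton.2
          (ihn (σ.length - (i + 1)) (by omega) ⟨i + 1, h⟩ rfl)⟩⟩)
        (.inr (.inr (.inr (.inr (.inr (.inl ⟨code_mod _ 5 (by omega), ?_⟩))))))
      have hl : (i : ℕ) + 1 < run.length := by rwa [hσ.length_eq]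
      rw [FiniteDataWord.sat_U_unfold]
      simp only [Formula.toCode, code_div _ 5 (show 5 < 8 by omega), Nat.unpair_pair, hl, h]
      by_cases h1 : σ.Sat w i φ <;> by_cases h2 : σ.Sat w i ψ <;>
        by_cases h3 : σ.Sat w ⟨i + 1, h⟩ (φ.U ψ) <;> simp [h1, h2, h3]
    · refine .of_justified [_, _] (List.forall_mem_cons.2 ⟨ih1 v w i hv,
        List.forall_mem_singleton.2 (ih2 v w i hv)⟩)
        (.inr (.inr (.inr (.inr (.inr (.inl ⟨code_mod _ 5 (by omega), ?_⟩))))))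
      have hl : ¬ (i : ℕ) + 1 < run.length := by rwa [hσ.length_eq]
      rw [FiniteDataWord.sat_U_unfold]
      simp only [Formula.toCode, code_div _ 5 (show 5 < 8 by omega), Nat.unpair_pair, hl, h]
      by_cases h2 : σ.Sat w i ψ <;> simp [h2]
  | F φ ih1 =>
    intro v w i hv
    induction hn : σ.length - (i : ℕ) using Nat.strong_induction_on generalizing i with
    | _ n ihn =>
    by_cases h : (i : ℕ) + 1 < σ.length
    · refine .of_justified [_, _] (List.forall_mem_cons.2 ⟨ih1 v w i hv,
        List.forall_mem_singleton.2 (ihn (σ.length - (i + 1)) (by omega) ⟨i + 1, h⟩ rfl)⟩)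
        (.inr (.inr (.inr (.inr (.inr (.inr (.inl ⟨code_mod _ 6 (by omega), ?_⟩)))))))
      have hl : (i : ℕ) + 1 < run.length := by rwa [hσ.length_eq]
      rw [FiniteDataWord.sat_F_unfold]
      simp only [Formula.toCode, code_div _ 6 (show 6 < 8 by omega), hl, h]
      by_cases h1 : σ.Sat w i φ <;>
        by_cases h3 : σ.Sat w ⟨i + 1, h⟩ (φ.F) <;> simp [h1, h3]
    · refine .of_justified [_] (List.forall_mem_singleton.2 (ih1 v w i hv))
        (.inr (.inr (.inr (.inr (.inr (.inr (.inl ⟨code_mod _ 6 (by omega), ?_⟩)))))))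
      have hl : ¬ (i : ℕ) + 1 < run.length := by rwa [hσ.length_eq]
      rw [FiniteDataWord.sat_F_unfold]
      simp only [Formula.toCode, code_div _ 6 (show 6 < 8 by omega), hl, h]
      by_cases h1 : σ.Sat w i φ <;> simp [h1]
  | freeze r φ ih =>
    intro v w i hv
    refine .of_justified [_] (List.forall_mem_singleton.2 (ih _ _ i (hv.update r i)))
      (.inr (.inr (.inr (.inr (.inr (.inr (.inr ⟨code_mod _ 7 (by omega), ?_⟩)))))))
    simp only [Formula.toCode, code_div _ 7 (show 7 < 8 by omega), Nat.unpair_pair,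
      FiniteDataWord.Sat, List.mem_singleton, Prod.mk.injEq, true_and]
    exact decide_eq_decide.2 Iff.rfl

/-- Satisfaction is witnessed by a finite closed set of judgments. -/
theorem Represents.models_iff {run : List (ℕ × ℕ)} {σ : FiniteDataWord ℕ} (hσ : Represents run σ)
    (φ : Formula ℕ) : σ.Models φ ↔
      ∃ D : List Judgment, (∀ j ∈ D, Justified run D j) ∧ (([], 0), φ.toCode, true) ∈ D := by
  classical
  have hd : ValuationList.Describes [] run fun _ : ℕ+ => (none : Option (Fin σ.length)) := by
    intro r x
    simp
  constructor
  · intro h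
    have := hσ.hasCertificate φ [] (fun _ => none) ⟨0, σ.length_pos⟩ hd
    rwa [decide_eq_true (show σ.Sat _ _ φ from h)] at this
  · rintro ⟨D, hD, hmem⟩
    exact (Justified.sound hσ hD φ [] (fun _ => none) ⟨0, σ.length_pos⟩ true hd hmem).1 rfl

/-! ### Certificates for the syntactic conditions on instances -/

/-- The subformula with code `x.2` uses only the given letters and the registers in `x.1`, provided that
the pairs in `S` do; if `fragment`, then it does not use `U` and registers other than `1`. -/
def Admissible (fragment : Bool) (states : List ℕ) (S : List (List ℕ × ℕ)) (x : List ℕ × ℕ) : Prop :=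
  (x.2 % 8 = 0 ∧ x.2 / 8 ∈ states) ∨
  (x.2 % 8 = 1 ∧ x.2 / 8 ∈ x.1 ∧ (fragment = false ∨ x.2 / 8 = 0)) ∨
  (x.2 % 8 = 2 ∧ (x.1, x.2 / 8) ∈ S) ∨
  (x.2 % 8 = 3 ∧ (x.1, (x.2 / 8).unpair.1) ∈ S ∧ (x.1, (x.2 / 8).unpair.2) ∈ S) ∨
  (x.2 % 8 = 4 ∧ (x.1, x.2 / 8) ∈ S) ∨
  (x.2 % 8 = 5 ∧ fragment = false ∧
    (x.1, (x.2 / 8).unpair.1) ∈ S ∧ (x.1, (x.2 / 8).unpair.2) ∈ S) ∨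
  (x.2 % 8 = 6 ∧ (x.1, x.2 / 8) ∈ S) ∨
  (x.2 % 8 = 7 ∧ (fragment = false ∨ (x.2 / 8).unpair.1 = 0) ∧
    ((x.2 / 8).unpair.1 :: x.1, (x.2 / 8).unpair.2) ∈ S)

theorem primrecPred_admissible (fragment : Bool) :
    PrimrecPred fun p : (List ℕ × List (List ℕ × ℕ)) × List ℕ × ℕ =>
      Admissible fragment p.1.1 p.1.2 p.2 := by
  let T := (List ℕ × List (List ℕ × ℕ)) × List ℕ × ℕ
  have st : Primrec fun p : T => p.1.1 := Primrec.fst.comp Primrec.fst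
  have S : Primrec fun p : T => p.1.2 := Primrec.snd.comp Primrec.fst
  have B : Primrec fun p : T => p.2.1 := Primrec.fst.comp Primrec.snd
  have c : Primrec fun p : T => p.2.2 := Primrec.snd.comp Primrec.snd
  have k : Primrec fun p : T => p.2.2 / 8 := Primrec.nat_div.comp c (Primrec.const 8)
  have k1 : Primrec fun p : T => (p.2.2 / 8).unpair.1 := Primrec.fst.comp (Primrec.unpair.comp k)
  have k2 : Primrec fun p : T => (p.2.2 / 8).unpair.2 := Primrec.snd.comp (Primrec.unpair.comp k)
  have m (a : ℕ) : PrimrecPred fun p : T => p.2.2 % 8 = a :=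
    Primrec.eq.comp (Primrec.nat_mod.comp c (Primrec.const 8)) (Primrec.const a)
  have ff : PrimrecPred fun _ : T => fragment = false :=
    Primrec.eq.comp (Primrec.const _) (Primrec.const _)
  have mem {f : T → List ℕ} {g : T → ℕ} (hf : Primrec f) (hg : Primrec g) :
      PrimrecPred fun p => (f p, g p) ∈ p.1.2 := primrecRel_mem.comp (hf.pair hg) S
  unfold Admissible
  refine .or ((m 0).and (primrecRel_mem.comp k st)) ?_
  refine .or ((m 1).and (.and (primrecRel_mem.comp k B)
    (ff.or (Primrec.eq.comp k (Primrec.const 0))))) ?_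
  refine .or ((m 2).and (mem B k)) ?_
  refine .or ((m 3).and ((mem B k1).and (mem B k2))) ?_
  refine .or ((m 4).and (mem B k)) ?_
  refine .or ((m 5).and (ff.and ((mem B k1).and (mem B k2)))) ?_
  refine .or ((m 6).and (mem B k)) ?_
  exact (m 7).and (.and (ff.or (Primrec.eq.comp k1 (Primrec.const 0)))
    (mem (Primrec.list_cons.comp k1 B) k2))

theorem Admissible.mono {fragment : Bool} {states : List ℕ} {S S' : List (List ℕ × ℕ)} (h : S ⊆ S')
    {x : List ℕ × ℕ} (hx : Admissible fragment states S x) : Admissible fragment states S' x := by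
  unfold Admissible at *
  have h' : ∀ x, x ∈ S → x ∈ S' := fun x hx => h hx
  rcases hx with hx | hx | hx | hx | hx | hx | hx | hx
  · exact .inl hx
  · exact .inr (.inl hx)
  · exact .inr (.inr (.inl ⟨hx.1, h' _ hx.2⟩))
  · exact .inr (.inr (.inr (.inl ⟨hx.1, h' _ hx.2.1, h' _ hx.2.2⟩)))
  · exact .inr (.inr (.inr (.inr (.inl ⟨hx.1, h' _ hx.2⟩))))
  · exact .inr (.inr (.inr (.inr (.inr (.inl ⟨hx.1, hx.2.1, h' _ hx.2.2.1, h' _ hx.2.2.2⟩)))))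
  · exact .inr (.inr (.inr (.inr (.inr (.inr (.inl ⟨hx.1, h' _ hx.2⟩))))))
  · exact .inr (.inr (.inr (.inr (.inr (.inr (.inr ⟨hx.1, hx.2.1, h' _ hx.2.2⟩))))))

/-- The letters of `φ` are among `states`, its free registers among `B`, and `φ` belongs to the
one-register fragment with temporal operators `X` and `F` if `fragment` is set. -/
def Formula.Fits (fragment : Bool) (states : List ℕ) : Formula ℕ → List ℕ → Prop
  | .letter a, _ => a ∈ states
  | .reg r, B => r.natPred ∈ B ∧ (fragment = false ∨ r.natPred = 0)
  | .neg φ, B => φ.Fits fragment states B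
  | .and φ ψ, B => φ.Fits fragment states B ∧ ψ.Fits fragment states B
  | .X φ, B => φ.Fits fragment states B
  | .U φ ψ, B => fragment = false ∧ φ.Fits fragment states B ∧ ψ.Fits fragment states B
  | .F φ, B => φ.Fits fragment states B
  | .freeze r φ, B => (fragment = false ∨ r.natPred = 0) ∧ φ.Fits fragment states (r.natPred :: B)

theorem natPred_eq_zero_iff (r : ℕ+) : r.natPred = 0 ↔ (r : ℕ) ≤ 1 := by
  have := r.pos
  simp only [PNat.natPred]
  omega

/-- `Fits` passes the bound registers downwards in `B`, whereas `freeRegisters` erases them upwards;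
the flag switches the restriction to the fragment on or off. -/
theorem Formula.fits_iff (fragment : Bool) (states : List ℕ) (φ : Formula ℕ) (B : List ℕ) :
    φ.Fits fragment states B ↔ (∀ a ∈ φ.letters, a ∈ states) ∧
      (∀ r ∈ φ.freeRegisters, r.natPred ∈ B) ∧
      (fragment = true → (∀ r ∈ φ.registers, (r : ℕ) ≤ 1) ∧
        φ.temporalOps ⊆ {TemporalOp.X, TemporalOp.F}) := by
  induction φ generalizing B with
  | letter a => simp [Fits, letters, freeRegisters, registers, temporalOps]
  | reg r =>
    simp only [Fits, letters, freeRegisters, registers, temporalOps, ← natPred_eq_zero_iff]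
    cases fragment <;> simp
  | neg φ ih => simp [Fits, letters, freeRegisters, registers, temporalOps, ih]
  | and φ ψ ih1 ih2 =>
    simp only [Fits, letters, freeRegisters, registers, temporalOps, ih1, ih2, Set.mem_union,
      Finset.mem_union, or_imp, forall_and, Finset.union_subset_iff]
    tauto
  | X φ ih =>
    simp only [Fits, letters, freeRegisters, registers, temporalOps, ih, Finset.insert_subset_iff]
    simp
  | U φ ψ ih1 ih2 =>
    simp only [Fits, letters, freeRegisters, registers, temporalOps, ih1, ih2, Set.mem_union,
      Finset.mem_union, or_imp, forall_and, Finset.union_subset_iff, Finset.insert_subset_iff]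
    cases fragment <;> simp
    tauto
  | F φ ih =>
    simp only [Fits, letters, freeRegisters, registers, temporalOps, ih, Finset.insert_subset_iff]
    simp
  | freeze r φ ih =>
    simp only [Fits, letters, freeRegisters, registers, temporalOps, ih, Finset.mem_insert,
      Finset.mem_erase, List.mem_cons, natPred_eq_zero_iff, forall_eq_or_imp, PNat.natPred_inj]
    have : (∀ r' ∈ φ.freeRegisters, r' = r ∨ r'.natPred ∈ B) ↔
        ∀ r', r' ≠ r ∧ r' ∈ φ.freeRegisters → r'.natPred ∈ B :=
      forall_congr' fun r' => by tauto
    rw [this]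
    cases fragment <;> simp
    tauto

/-- A certificate is a list closed under passing to immediate subformulae with their bound
registers; entries only refer to smaller codes, so it cannot be circular. -/
theorem Formula.fits_iff_exists (fragment : Bool) (states : List ℕ) (φ : Formula ℕ) (B : List ℕ) :
    φ.Fits fragment states B ↔ ∃ S : List (List ℕ × ℕ),
      (∀ x ∈ S, Admissible fragment states S x) ∧ (B, φ.toCode) ∈ S := by
  constructor
  · have add {S : List (List ℕ × ℕ)} {x} (hS : ∀ x ∈ S, Admissible fragment states S x)
        (hx : Admissible fragment states S x) : ∃ S : List (List ℕ × ℕ),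
        (∀ x ∈ S, Admissible fragment states S x) ∧ x ∈ S := by
      refine ⟨x :: S, ?_, List.mem_cons_self⟩
      intro y hy
      rcases List.mem_cons.1 hy with rfl | hy
      · exact hx.mono (List.subset_cons_self _ _)
      · exact (hS y hy).mono (List.subset_cons_self _ _)
    have join {S₁ S₂ : List (List ℕ × ℕ)} (h1 : ∀ x ∈ S₁, Admissible fragment states S₁ x)
        (h2 : ∀ x ∈ S₂, Admissible fragment states S₂ x) :
        ∀ x ∈ S₁ ++ S₂, Admissible fragment states (S₁ ++ S₂) x := by
      intro x hx
      rcases List.mem_append.1 hx with hx | hx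
      · exact (h1 x hx).mono (List.subset_append_left _ _)
      · exact (h2 x hx).mono (List.subset_append_right _ _)
    induction φ generalizing B with
    | letter a => exact fun h => add (S := []) (by simp) (.inl (by simpa [toCode, Fits] using h))
    | reg r =>
      intro h
      refine add (S := []) (by simp) (.inr (.inl ⟨code_mod _ 1 (by omega), ?_⟩))
      simpa only [toCode, code_div _ 1 (show 1 < 8 by omega), Fits] using h
    | neg φ ih =>
      intro h
      obtain ⟨S, hS, hm⟩ := ih B h
      refine add hS (.inr (.inr (.inl ⟨code_mod _ 2 (by omega), ?_⟩)))
      simpa only [toCode, code_div _ 2 (show 2 < 8 by omega)] using hm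
    | and φ ψ ih1 ih2 =>
      intro h
      obtain ⟨S₁, hS₁, hm₁⟩ := ih1 B h.1
      obtain ⟨S₂, hS₂, hm₂⟩ := ih2 B h.2
      refine add (join hS₁ hS₂) (.inr (.inr (.inr (.inl ⟨code_mod _ 3 (by omega), ?_⟩))))
      simp only [toCode, code_div _ 3 (show 3 < 8 by omega), Nat.unpair_pair]
      exact ⟨List.mem_append_left _ hm₁, List.mem_append_right _ hm₂⟩
    | X φ ih =>
      intro h
      obtain ⟨S, hS, hm⟩ := ih B h
      refine add hS (.inr (.inr (.inr (.inr (.inl ⟨code_mod _ 4 (by omega), ?_⟩)))))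
      simpa only [toCode, code_div _ 4 (show 4 < 8 by omega)] using hm
    | U φ ψ ih1 ih2 =>
      intro h
      obtain ⟨S₁, hS₁, hm₁⟩ := ih1 B h.2.1
      obtain ⟨S₂, hS₂, hm₂⟩ := ih2 B h.2.2
      refine add (join hS₁ hS₂)
        (.inr (.inr (.inr (.inr (.inr (.inl ⟨code_mod _ 5 (by omega), h.1, ?_⟩))))))
      simp only [toCode, code_div _ 5 (show 5 < 8 by omega), Nat.unpair_pair]
      exact ⟨List.mem_append_left _ hm₁, List.mem_append_right _ hm₂⟩
    | F φ ih =>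
      intro h
      obtain ⟨S, hS, hm⟩ := ih B h
      refine add hS
        (.inr (.inr (.inr (.inr (.inr (.inr (.inl ⟨code_mod _ 6 (by omega), ?_⟩)))))))
      simpa only [toCode, code_div _ 6 (show 6 < 8 by omega)] using hm
    | freeze r φ ih =>
      intro h
      obtain ⟨S, hS, hm⟩ := ih _ h.2
      refine add hS
        (.inr (.inr (.inr (.inr (.inr (.inr (.inr ⟨code_mod _ 7 (by omega), ?_⟩)))))))
      simp only [toCode, code_div _ 7 (show 7 < 8 by omega), Nat.unpair_pair]
      exact ⟨h.1, hm⟩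
  · rintro ⟨S, hS, hm⟩
    induction φ generalizing B with
    | letter a =>
      have := hS _ hm
      have h0 := code_div a 0 (by omega)
      have h1 := code_mod a 0 (by omega)
      simp only [add_zero] at h0 h1
      simpa [Admissible, toCode, h0, h1, Fits] using this
    | reg r =>
      have := hS _ hm
      simpa [Admissible, toCode, code_div, code_mod, Fits] using this
    | neg φ ih =>
      have := hS _ hm
      simp only [Admissible, toCode, code_div _ 2 (show 2 < 8 by omega),
        code_mod _ 2 (show 2 < 8 by omega)] at this
      exact ih B (by simpa using this)
    | and φ ψ ih1 ih2 =>
      have := hS _ hm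
      simp only [Admissible, toCode, code_div _ 3 (show 3 < 8 by omega), Nat.unpair_pair,
        code_mod _ 3 (show 3 < 8 by omega)] at this
      simp only [OfNat.ofNat_ne_zero, false_and, OfNat.ofNat_ne_one, true_and, Nat.reduceEqDiff,
        or_false, false_or] at this
      exact ⟨ih1 B this.1, ih2 B this.2⟩
    | X φ ih =>
      have := hS _ hm
      simp only [Admissible, toCode, code_div _ 4 (show 4 < 8 by omega),
        code_mod _ 4 (show 4 < 8 by omega)] at this
      exact ih B (by simpa using this)
    | U φ ψ ih1 ih2 =>
      have := hS _ hm
      simp only [Admissible, toCode, code_div _ 5 (show 5 < 8 by omega), Nat.unpair_pair,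
        code_mod _ 5 (show 5 < 8 by omega)] at this
      simp only [OfNat.ofNat_ne_zero, false_and, OfNat.ofNat_ne_one, true_and, Nat.reduceEqDiff,
        or_false, false_or] at this
      exact ⟨this.1, ih1 B this.2.1, ih2 B this.2.2⟩
    | F φ ih =>
      have := hS _ hm
      simp only [Admissible, toCode, code_div _ 6 (show 6 < 8 by omega),
        code_mod _ 6 (show 6 < 8 by omega)] at this
      exact ih B (by simpa using this)
    | freeze r φ ih =>
      have := hS _ hm
      simp only [Admissible, toCode, code_div _ 7 (show 7 < 8 by omega), Nat.unpair_pair,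
        code_mod _ 7 (show 7 < 8 by omega)] at this
      simp only [OfNat.ofNat_ne_zero, false_and, OfNat.ofNat_ne_one, true_and, Nat.reduceEqDiff,
        false_or] at this
      exact ⟨this.1, ih _ this.2⟩

/-! ### Runs as lists of configurations -/

theorem getD_ofFn {α : Type} {n : ℕ} (f : Fin n → α) (d : α) {i : ℕ} (h : i < n) :
    (List.ofFn f).getD i d = f ⟨i, h⟩ := by
  simp [h]

namespace OneCounterAutomaton

/-- `run` is the sequence of configurations of an accepting run. -/
def IsAcceptingRun (A : OneCounterAutomaton) (run : List (ℕ × ℕ)) : Prop :=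
  0 < run.length ∧ run.getD 0 (0, 0) = (A.init, 0) ∧
    (∀ i < run.length - 1, A.Step (run.getD i (0, 0)) (run.getD (i + 1) (0, 0))) ∧
    (run.getD (run.length - 1) (0, 0)).1 ∈ A.accept

theorem primrec_equivTuple : Primrec equivTuple := Primrec.of_equiv
theorem primrec_states : Primrec states := Primrec.fst.comp primrec_equivTuple
theorem primrec_init : Primrec init :=
  Primrec.fst.comp (Primrec.snd.comp primrec_equivTuple)
theorem primrec_trans : Primrec trans :=
  Primrec.fst.comp (Primrec.snd.comp (Primrec.snd.comp primrec_equivTuple))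
theorem primrec_accept : Primrec accept :=
  Primrec.snd.comp (Primrec.snd.comp (Primrec.snd.comp primrec_equivTuple))

theorem primrecPred_step : PrimrecPred fun p : OneCounterAutomaton × (ℕ × ℕ) × ℕ × ℕ =>
    p.1.Step p.2.1 p.2.2 := by
  let T := OneCounterAutomaton × (ℕ × ℕ) × ℕ × ℕ
  have tr : Primrec fun p : T => p.1.trans := primrec_trans.comp Primrec.fst
  have q : Primrec fun p : T => p.2.1.1 := Primrec.fst.comp (Primrec.fst.comp Primrec.snd)
  have n : Primrec fun p : T => p.2.1.2 := Primrec.snd.comp (Primrec.fst.comp Primrec.snd)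
  have q' : Primrec fun p : T => p.2.2.1 := Primrec.fst.comp (Primrec.snd.comp Primrec.snd)
  have n' : Primrec fun p : T => p.2.2.2 := Primrec.snd.comp (Primrec.snd.comp Primrec.snd)
  have mem (a : Instr) : PrimrecPred fun p : T => (p.2.1.1, a, p.2.2.1) ∈ p.1.trans :=
    primrecRel_mem.comp (q.pair ((Primrec.const a).pair q')) tr
  exact ((mem _).and (Primrec.eq.comp n' (Primrec.succ.comp n))).or
    (((mem _).and (Primrec.eq.comp n (Primrec.succ.comp n'))).or
      ((mem _).and ((Primrec.eq.comp n (Primrec.const 0)).and (Primrec.eq.comp n' (Primrec.const 0)))))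

theorem primrecPred_isAcceptingRun :
    PrimrecPred fun p : OneCounterAutomaton × List (ℕ × ℕ) => p.1.IsAcceptingRun p.2 := by
  let T := OneCounterAutomaton × List (ℕ × ℕ)
  have len : Primrec fun p : T => p.2.length := Primrec.list_length.comp Primrec.snd
  have pre : Primrec fun p : T => p.2.length - 1 := Primrec.nat_sub.comp len (Primrec.const 1)
  have get {β : Type} [Primcodable β] {f : β → T} {g : β → ℕ} (hf : Primrec f) (hg : Primrec g) :
      Primrec fun p => (f p).2.getD (g p) (0, 0) :=
    (Primrec.list_getD _).comp (Primrec.snd.comp hf) hg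
  have hstep : PrimrecRel fun (i : ℕ) (p : T) =>
      p.1.Step (p.2.getD i (0, 0)) (p.2.getD (i + 1) (0, 0)) :=
    primrecPred_step.comp ((Primrec.fst.comp Primrec.snd).pair
      ((get Primrec.snd Primrec.fst).pair (get Primrec.snd (Primrec.succ.comp Primrec.fst))))
  refine (Primrec.nat_lt.comp (Primrec.const 0) len).and (.and ?_ (.and ?_ ?_))
  · exact Primrec.eq.comp (get Primrec.id (Primrec.const 0))
      ((primrec_init.comp Primrec.fst).pair (Primrec.const 0))
  · exact (hstep.forall_mem_list.comp (Primrec.list_range.comp pre) (Primrec.id (α := T))).of_eq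
      fun p => by simp
  · exact primrecRel_mem.comp (Primrec.fst.comp (get Primrec.id pre))
      (primrec_accept.comp Primrec.fst)

theorem primrecPred_wellFormed : PrimrecPred WellFormed := by
  have hm : PrimrecRel fun (q : ℕ) (A : OneCounterAutomaton) => q ∈ A.states :=
    primrecRel_mem.comp Primrec.fst (primrec_states.comp Primrec.snd)
  have ht : PrimrecRel fun (t : ℕ × Instr × ℕ) (A : OneCounterAutomaton) =>
      t.1 ∈ A.states ∧ t.2.2 ∈ A.states :=
    (hm.comp (Primrec.fst.comp Primrec.fst) Primrec.snd).and
      (hm.comp (Primrec.snd.comp (Primrec.snd.comp Primrec.fst)) Primrec.snd)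
  exact (hm.comp primrec_init Primrec.id).and ((ht.forall_mem_list.comp primrec_trans Primrec.id).and
    (hm.forall_mem_list.comp primrec_accept Primrec.id))

theorem FiniteRun.represents {A : OneCounterAutomaton} (ρ : A.FiniteRun) :
    Represents (List.ofFn ρ.config) ρ.toDataWord where
  length_eq := List.length_ofFn
  letter_eq := fun (i : Fin (ρ.steps + 1)) => by
    rw [getD_ofFn _ _ i.2]
    rfl
  sim_iff := fun (i j : Fin (ρ.steps + 1)) => by
    rw [getD_ofFn _ _ i.2, getD_ofFn _ _ j.2]
    exact Iff.rfl

theorem FiniteRun.Accepting.isAcceptingRun {A : OneCounterAutomaton} {ρ : A.FiniteRun}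
    (h : ρ.Accepting) : A.IsAcceptingRun (List.ofFn ρ.config) := by
  rw [IsAcceptingRun, List.length_ofFn, getD_ofFn _ _ ρ.steps.succ_pos]
  refine ⟨ρ.steps.succ_pos, ρ.start, ?_, ?_⟩
  · intro i hi
    have h1 : i < ρ.steps := by simpa using hi
    rw [getD_ofFn _ _ (Nat.lt_succ_of_lt h1), getD_ofFn _ _ (Nat.succ_lt_succ h1)]
    exact ρ.step ⟨i, h1⟩
  · rw [getD_ofFn _ _ (by omega)]
    exact h

theorem IsAcceptingRun.exists_finiteRun {A : OneCounterAutomaton} {run : List (ℕ × ℕ)}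
    (h : A.IsAcceptingRun run) :
    ∃ ρ : A.FiniteRun, ρ.Accepting ∧ List.ofFn ρ.config = run := by
  obtain ⟨h0, h1, h2, h3⟩ := h
  refine ⟨⟨run.length - 1, fun i => run.getD i (0, 0), by simpa using h1,
    fun i => by simpa using h2 i i.2⟩, by simpa [FiniteRun.Accepting] using h3, ?_⟩
  refine List.ext_getElem (by rw [List.length_ofFn]; exact Nat.sub_add_cancel h0)
    fun i hi hi' => ?_
  simp [hi', -List.ofFn_succ]

end OneCounterAutomaton

theorem isInstance_and_iff (fragment : Bool) (x : OneCounterAutomaton × Formula ℕ) :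
    (IsInstance x ∧ (fragment = true → (∀ r ∈ x.2.registers, (r : ℕ) ≤ 1) ∧
        x.2.temporalOps ⊆ {TemporalOp.X, TemporalOp.F})) ↔
      x.1.WellFormed ∧ x.2.Fits fragment x.1.states [] := by
  rw [Formula.fits_iff]
  simp only [IsInstance, Formula.IsSentence, List.not_mem_nil, imp_false,
    Finset.eq_empty_iff_forall_notMem]
  tauto

theorem primrec_toCode : Primrec Formula.toCode :=
  Primrec.of_equiv (e := Formula.equivNat)

/-- A witness consists of an accepting run, a syntactic certificate and a satisfaction certificate.
The flag covers the full and the restricted problem in one argument. -/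
theorem rePred_modelChecking (fragment : Bool) :
    REPred fun x : OneCounterAutomaton × Formula ℕ => FinitaryMC x ∧
      (fragment = true → (∀ r ∈ x.2.registers, (r : ℕ) ≤ 1) ∧
        x.2.temporalOps ⊆ {TemporalOp.X, TemporalOp.F}) := by
  let W := List (ℕ × ℕ) × List (List ℕ × ℕ) × List Judgment
  let I := OneCounterAutomaton × Formula ℕ
  let P : I → W → Prop := fun x w =>
    (x.1.WellFormed ∧ (∀ y ∈ w.2.1, Admissible fragment x.1.states w.2.1 y) ∧
      ([], x.2.toCode) ∈ w.2.1) ∧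
    x.1.IsAcceptingRun w.1 ∧ (∀ j ∈ w.2.2, Justified w.1 w.2.2 j) ∧
      (([], 0), x.2.toCode, true) ∈ w.2.2
  have hP : PrimrecRel P := by
    have A : Primrec fun p : I × W => p.1.1 := Primrec.fst.comp Primrec.fst
    have c : Primrec fun p : I × W => p.1.2.toCode :=
      primrec_toCode.comp (Primrec.snd.comp Primrec.fst)
    have run : Primrec fun p : I × W => p.2.1 := Primrec.fst.comp Primrec.snd
    have S : Primrec fun p : I × W => p.2.2.1 := Primrec.fst.comp (Primrec.snd.comp Primrec.snd)
    have D : Primrec fun p : I × W => p.2.2.2 := Primrec.snd.comp (Primrec.snd.comp Primrec.snd)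
    have adm : PrimrecRel fun (y : List ℕ × ℕ) (p : List ℕ × List (List ℕ × ℕ)) =>
        Admissible fragment p.1 p.2 y :=
      (primrecPred_admissible fragment).comp (Primrec.snd.pair Primrec.fst)
    have jus : PrimrecRel fun (y : Judgment) (p : List (ℕ × ℕ) × List Judgment) =>
        Justified p.1 p.2 y := primrecPred_justified.comp (Primrec.snd.pair Primrec.fst)
    refine .and (.and (OneCounterAutomaton.primrecPred_wellFormed.comp A) (.and ?_ ?_))
      (.and (OneCounterAutomaton.primrecPred_isAcceptingRun.comp (A.pair run)) (.and ?_ ?_))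
    · exact adm.forall_mem_list.comp S ((OneCounterAutomaton.primrec_states.comp A).pair S)
    · exact primrecRel_mem.comp ((Primrec.const []).pair c) S
    · exact jus.forall_mem_list.comp D (run.pair D)
    · exact primrecRel_mem.comp ((Primrec.const ([], 0)).pair (c.pair (Primrec.const true))) D
  refine (rePred_exists hP).of_eq fun x => ?_
  have hx := isInstance_and_iff fragment x
  rw [Formula.fits_iff_exists] at hx
  constructor
  · rintro ⟨⟨run, S, D⟩, ⟨hwf, hS, hmem⟩, hrun, hD, hφ⟩
    obtain ⟨ρ, hacc, hρ⟩ := hrun.exists_finiteRun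
    have hrep := ρ.represents
    rw [hρ] at hrep
    have := hx.2 ⟨hwf, S, hS, hmem⟩
    exact ⟨⟨this.1, ρ, hacc, (hrep.models_iff x.2).2 ⟨D, hD, hφ⟩⟩, this.2⟩
  · rintro ⟨⟨hI, ρ, hacc, hφ⟩, hf⟩
    obtain ⟨hwf, S, hS, hmem⟩ := hx.1 ⟨hI, hf⟩
    obtain ⟨D, hD, hj⟩ := (ρ.represents.models_iff x.2).1 hφ
    exact ⟨⟨List.ofFn ρ.config, S, D⟩, ⟨hwf, hS, hmem⟩, hacc.isAcceptingRun, hD, hj⟩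

theorem rePred_finitaryMC : REPred FinitaryMC :=
  (rePred_modelChecking false).of_eq fun x => by simp

theorem rePred_finitaryMCRestricted :
    REPred (FinitaryMCRestricted 1 {TemporalOp.X, TemporalOp.F}) :=
  (rePred_modelChecking true).of_eq fun x => by simp [FinitaryMCRestricted]

/-! ### Regular programs over counters -/

/-- The operations on a family of counters: an instruction for one of them, or no operation. -/
abbrev CounterOp := Option (Instr × ℕ)

/-- The effect of an operation. -/
def CounterOp.Sem : CounterOp → (ℕ → ℕ) → (ℕ → ℕ) → Prop
  | none, s, s' => s' = s
  | some (.inc, c), s, s' => s' = update s c (s c + 1)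
  | some (.dec, c), s, s' => s c ≠ 0 ∧ s' = update s c (s c - 1)
  | some (.ifzero, c), s, s' => s c = 0 ∧ s' = s

/-- Regular programs. -/
inductive Prog : Type
  | op (o : CounterOp)
  | seq (P Q : Prog)
  | star (P : Prog)
  deriving Countable

namespace Prog

/-- The relation computed by a program. -/
def Sem : Prog → (ℕ → ℕ) → (ℕ → ℕ) → Prop
  | op o => o.Sem
  | seq P Q => Relation.Comp P.Sem Q.Sem
  | star P => Relation.ReflTransGen P.Sem

theorem sem_seq_iff {P Q : Prog} {s s' : ℕ → ℕ} :
    (seq P Q).Sem s s' ↔ ∃ t, P.Sem s t ∧ Q.Sem t s' := Iff.rfl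

theorem sem_seq_of_left {P Q : Prog} {s t s' : ℕ → ℕ} (h : ∀ t', P.Sem s t' ↔ t' = t) :
    (seq P Q).Sem s s' ↔ Q.Sem t s' := by
  simp [Sem, Relation.Comp, h]

/-- For a deterministic loop body: `σ k` is the store after `k` rounds and `G k` the guard for one
more round. Only the number of rounds is left to choice. -/
theorem sem_star {P : Prog} (σ : ℕ → ℕ → ℕ) (G : ℕ → Prop)
    (h : ∀ k s', P.Sem (σ k) s' ↔ G k ∧ s' = σ (k + 1)) {s' : ℕ → ℕ} :
    (star P).Sem (σ 0) s' ↔ ∃ k, (∀ j < k, G j) ∧ s' = σ k := by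
  constructor
  · intro hs
    induction hs with
    | refl => exact ⟨0, by simp, rfl⟩
    | tail _ hst ih =>
      obtain ⟨k, hk, rfl⟩ := ih
      obtain ⟨h1, h2⟩ := (h k _).1 hst
      exact ⟨k + 1, fun j hj => (Nat.lt_succ_iff_lt_or_eq.1 hj).elim (hk j) fun e => e ▸ h1, h2⟩
  · rintro ⟨k, hk, rfl⟩
    induction k with
    | zero => exact .refl
    | succ k ih =>
      exact (ih fun j hj => hk j (by omega)).tail ((h k _).2 ⟨hk k (by omega), rfl⟩)

/-- Increment all counters in a list. -/
def incs : List ℕ → Prog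
  | [] => op none
  | c :: l => seq (incs l) (op (some (.inc, c)))

theorem sem_incs {l : List ℕ} (hl : l.Nodup) (s s' : ℕ → ℕ) :
    (incs l).Sem s s' ↔ s' = fun j => if j ∈ l then s j + 1 else s j := by
  induction l generalizing s' with
  | nil => simp [incs, Sem, CounterOp.Sem]
  | cons c l ih =>
    rw [incs, sem_seq_of_left (ih (List.nodup_cons.1 hl).2)]
    simp only [Sem, CounterOp.Sem]
    refine Eq.congr_right (funext fun j => ?_)
    have := (List.nodup_cons.1 hl).1
    by_cases hj : j = c
    · subst hj
      simp [this]
    · simp [hj]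

/-- Set `x` to zero and add its old value to all counters in `l`. -/
def drain (x : ℕ) (l : List ℕ) : Prog :=
  seq (star (seq (op (some (.dec, x))) (incs l))) (op (some (.ifzero, x)))

/-- The loop may stop at any time, but only the executions that have emptied `x` survive the final
zero test, so the program is deterministic as a relation. -/
theorem sem_drain {x : ℕ} {l : List ℕ} (hl : (x :: l).Nodup) (s s' : ℕ → ℕ) :
    (drain x l).Sem s s' ↔
      s' = fun j => if j = x then 0 else if j ∈ l then s j + s x else s j := by
  obtain ⟨hx, hl⟩ := List.nodup_cons.1 hl
  -- The store after `k` rounds; the truncated subtraction is genuine under the guard `k < s x`.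
  let σ : ℕ → ℕ → ℕ := fun k j => if j = x then s x - k else if j ∈ l then s j + k else s j
  have h0 : s = σ 0 := by
    funext j
    by_cases hj : j = x <;> simp [σ, hj]
  have hstar : ∀ t, (star (seq (op (some (.dec, x))) (incs l))).Sem s t ↔
      ∃ k, (∀ j < k, j < s x) ∧ t = σ k := by
    intro t
    conv_lhs => rw [h0]
    refine sem_star σ (fun k => k < s x) fun k s' => ?_
    simp only [Sem, Relation.Comp, CounterOp.Sem, sem_incs hl, and_assoc]
    have e1 : σ k x = s x - k := by simp [σ]
    rw [e1]
    simp only [exists_and_left, exists_eq_left]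
    refine and_congr (by omega) (Eq.congr_right (funext fun j => ?_))
    by_cases hj : j = x
    · subst hj
      simp [hx, σ]
      omega
    · by_cases hj' : j ∈ l <;> simp [hj, hj', σ]
      omega
  simp only [drain, Sem, Relation.Comp, CounterOp.Sem] at hstar ⊢
  simp only [hstar]
  constructor
  · rintro ⟨t, ⟨k, hk, rfl⟩, h1, rfl⟩
    have h2 : k = s x := by
      have e1 : σ k x = s x - k := by simp [σ]
      rcases k.eq_zero_or_pos with rfl | hpos
      · omega
      · have := hk (k - 1) (by omega)
        omega
    simp [σ, h2]
  · rintro rfl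
    refine ⟨_, ⟨s x, fun _ h => h, rfl⟩, by simp [σ], ?_⟩
    simp [σ]

/-- Add `x` to `y`, using the auxiliary counter `z`. -/
def add (x y z : ℕ) : Prog := seq (drain x [y, z]) (drain z [x])

/-- Draining `x` into `y` destroys `x`, so a second copy is collected in `z` and drained back. -/
theorem sem_add {x y z : ℕ} (hxy : x ≠ y) (hxz : x ≠ z) (hyz : y ≠ z) {s : ℕ → ℕ} (hz : s z = 0)
    (s' : ℕ → ℕ) : (add x y z).Sem s s' ↔ s' = update s y (s y + s x) := by
  rw [add, sem_seq_of_left (sem_drain (by simp [hxy, hxz, hyz]) s), sem_drain (by simp [hxz.symm])]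
  refine Eq.congr_right (funext fun j => ?_)
  simp only [update_apply, List.mem_cons, List.not_mem_nil, or_false]
  grind

/-- Succeeds if `x` and `y` have the same value; sets both to zero. -/
def test (x y : ℕ) : Prog :=
  seq (star (seq (op (some (.dec, x))) (op (some (.dec, y)))))
    (seq (op (some (.ifzero, x))) (op (some (.ifzero, y))))

theorem sem_test {x y : ℕ} (hxy : x ≠ y) (s s' : ℕ → ℕ) :
    (test x y).Sem s s' ↔ s x = s y ∧ s' = fun j => if j = x ∨ j = y then 0 else s j := by
  let σ : ℕ → ℕ → ℕ := fun k j => if j = x ∨ j = y then s j - k else s j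
  have h0 : s = σ 0 := by
    funext j
    simp [σ]
  have hstar : ∀ t, (star (seq (op (some (.dec, x))) (op (some (.dec, y))))).Sem s t ↔
      ∃ k, (∀ j < k, j < s x ∧ j < s y) ∧ t = σ k := by
    intro t
    conv_lhs => rw [h0]
    refine sem_star σ (fun k => k < s x ∧ k < s y) fun k s' => ?_
    simp only [Sem, Relation.Comp, CounterOp.Sem, and_assoc]
    have e1 : σ k x = s x - k := by simp [σ]
    have e2 : σ k y = s y - k := by simp [σ]
    simp only [exists_and_left, exists_eq_left, update_of_ne hxy.symm, e1, e2]
    refine and_congr (by omega) (and_congr (by omega) (Eq.congr_right (funext fun j => ?_)))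
    simp only [update_apply, σ]
    grind
  simp only [test, Sem, Relation.Comp, CounterOp.Sem] at hstar ⊢
  simp only [hstar]
  constructor
  · rintro ⟨t, ⟨k, hk, rfl⟩, t, ⟨h1, rfl⟩, h2, rfl⟩
    have e1 : σ k x = s x - k := by simp [σ]
    have e2 : σ k y = s y - k := by simp [σ]
    have h3 : k = s x ∧ k = s y := by
      rcases k.eq_zero_or_pos with rfl | hpos
      · omega
      · have := hk (k - 1) (by omega)
        omega
    refine ⟨by omega, funext fun j => ?_⟩
    simp only [σ]
    grind
  · rintro ⟨h, rfl⟩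
    refine ⟨_, ⟨s x, fun _ h' => ⟨h', h ▸ h'⟩, rfl⟩, _, ⟨by simp [σ], rfl⟩, by simp [σ, h], ?_⟩
    funext j
    simp only [σ]
    grind

/-- Run the first `k` programs of a sequence. -/
def seqUpTo (P : ℕ → Prog) : ℕ → Prog
  | 0 => op none
  | k + 1 => seq (seqUpTo P k) (P k)

theorem sem_seqUpTo {P : ℕ → Prog} {n : ℕ} (σ : ℕ → ℕ → ℕ)
    (h : ∀ k < n, ∀ s', (P k).Sem (σ k) s' ↔ s' = σ (k + 1)) (s' : ℕ → ℕ) :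
    (seqUpTo P n).Sem (σ 0) s' ↔ s' = σ n := by
  induction n generalizing s' with
  | zero => simp [seqUpTo, Sem, CounterOp.Sem]
  | succ n ih =>
    rw [seqUpTo, sem_seq_of_left (ih fun k hk => h k (by omega))]
    exact h n (by omega) s'

/-! ### Counter programs for primitive recursive functions -/

/-- `P` adds to `y` the value of `f` at the contents of the counters `xs`, provided that the counters from `b` on
are zero. -/
def Computes (P : Prog) {n : ℕ} (f : List.Vector ℕ n → ℕ) (xs : Fin n → ℕ) (y b : ℕ) : Prop :=
  ∀ s : ℕ → ℕ, (∀ j, b ≤ j → s j = 0) → ∀ s', P.Sem s s' ↔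
    s' = update s y (s y + f (List.Vector.ofFn fun i => s (xs i)))

/-- The values of the `g i` are collected in the counters `b + i`, with scratch space from `b + n`
on; `f` is evaluated on them, and they are cleared so that the program can be used again inside a
loop. -/
theorem exists_computes_comp {m n : ℕ} {f : List.Vector ℕ n → ℕ} (g : Fin n → List.Vector ℕ m → ℕ)
    (xs : Fin m → ℕ) (y b : ℕ) (hx : ∀ i, xs i < b) (hy : y < b)
    {Pf : Prog} (hf : Pf.Computes f (fun i => b + i) y (b + n))
    {Pg : Fin n → Prog} (hg : ∀ i, (Pg i).Computes (g i) xs (b + i) (b + n)) :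
    ∃ P : Prog, P.Computes (fun v => f (List.Vector.ofFn fun i => g i v)) xs y b := by
  refine ⟨seq (seqUpTo (fun i => if h : i < n then Pg ⟨i, h⟩ else op none) n)
    (seq Pf (seqUpTo (fun i => drain (b + i) []) n)), fun s hs s' => ?_⟩
  set v := List.Vector.ofFn fun i => s (xs i) with hv
  let σ : ℕ → ℕ → ℕ := fun k j => if h : b ≤ j ∧ j < b + k ∧ j < b + n then
    g ⟨j - b, by omega⟩ v else s j
  have h0 : s = σ 0 := by
    funext j
    simp only [σ]
    grind
  have h1 : ∀ t, (seqUpTo (fun i => if h : i < n then Pg ⟨i, h⟩ else op none) n).Sem s t ↔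
      t = σ n := by
    intro t
    conv_lhs => rw [h0]
    refine sem_seqUpTo σ (fun k hk s' => ?_) t
    have e : (List.Vector.ofFn fun i => σ k (xs i)) = v := by
      rw [hv]
      congr 1
      funext i
      have := hx i
      simp only [σ]
      rw [dif_neg (by omega)]
    rw [dif_pos hk, hg ⟨k, hk⟩ (σ k) (fun j hj => ?_), e]
    · refine Eq.congr_right (funext fun j => ?_)
      by_cases hj : j = b + k
      · subst hj
        have := hs (b + k) (by omega)
        simp [σ, hk, this]
      · simp only [update_of_ne hj, σ]
        grind
    · simp only [σ]
      rw [dif_neg (by omega)]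
      exact hs j (by omega)
  have h2 : ∀ t, Pf.Sem (σ n) t ↔ t = update (σ n) y (s y + f (List.Vector.ofFn fun i => g i v)) := by
    intro t
    rw [hf (σ n) fun j hj => ?_]
    · have e1 : σ n y = s y := by
        simp only [σ]
        rw [dif_neg (by omega)]
      have e2 : (fun i : Fin n => σ n (b + i)) = fun i => g i v := by
        funext i
        simp [σ]
      rw [e1, e2]
    · simp only [σ]
      rw [dif_neg (by omega)]
      exact hs j (by omega)
  rw [sem_seq_of_left h1, sem_seq_of_left h2]
  -- The store after the first `k` intermediate values have been cleared.
  let τ : ℕ → ℕ → ℕ := fun k j => if b ≤ j ∧ j < b + k then 0 else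
    update (σ n) y (s y + f (List.Vector.ofFn fun i => g i v)) j
  have h3 : update (σ n) y (s y + f (List.Vector.ofFn fun i => g i v)) = τ 0 := by
    funext j
    simp only [τ]
    rw [if_neg (by omega)]
  rw [h3, sem_seqUpTo τ fun k hk s' => ?_]
  · refine Eq.congr_right (funext fun j => ?_)
    simp only [τ, σ, update_apply]
    grind
  · rw [sem_drain (by simp)]
    refine Eq.congr_right (funext fun j => ?_)
    simp only [τ, List.not_mem_nil, if_false]
    grind

/-- Counter `b` holds the number of rounds, `b + 1` the current value of the recursion and `b + 2`
the next value; scratch space starts at `b + 3`. The number of rounds is guessed and compared with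
the first argument afterwards. -/
theorem exists_computes_prec {n : ℕ} {f : List.Vector ℕ n → ℕ} {g : List.Vector ℕ (n + 2) → ℕ}
    (xs : Fin (n + 1) → ℕ) (y b : ℕ) (hx : ∀ i, xs i < b ∧ xs i ≠ y) (hy : y < b)
    {Pf : Prog} (hf : Pf.Computes f (fun i => xs i.succ) (b + 1) (b + 3))
    {Pg : Prog} (hg : Pg.Computes g (Fin.cons b (Fin.cons (b + 1) fun i => xs i.succ))
      (b + 2) (b + 3)) :
    ∃ P : Prog, P.Computes (fun v : List.Vector ℕ (n + 1) =>
      v.head.rec (f v.tail) fun k r => g (k ::ᵥ r ::ᵥ v.tail)) xs y b := by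
  refine ⟨seq Pf (seq (star (seq Pg (seq (drain (b + 1) []) (seq (drain (b + 2) [b + 1])
    (op (some (.inc, b))))))) (seq (add (xs 0) (b + 2) (b + 3)) (seq (test b (b + 2))
      (drain (b + 1) [y])))), fun s hs s' => ?_⟩
  set v := List.Vector.ofFn fun i => s (xs i.succ) with hv
  have hvec : (List.Vector.ofFn fun i => s (xs i)) = s (xs 0) ::ᵥ v := rfl
  simp only [hvec, List.Vector.head_cons, List.Vector.tail_cons]
  let r : ℕ → ℕ := fun k => k.rec (f v) fun k r => g (k ::ᵥ r ::ᵥ v)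
  let σ : ℕ → ℕ → ℕ := fun k j => if j = b then k else if j = b + 1 then r k else s j
  have hsb := hs b (by omega)
  have hsb1 := hs (b + 1) (by omega)
  have hsb2 := hs (b + 2) (by omega)
  have hsb3 := hs (b + 3) (by omega)
  have hx0 := hx 0
  have h1 : ∀ t, Pf.Sem s t ↔ t = σ 0 := by
    intro t
    rw [hf s fun j hj => hs j (by omega)]
    refine Eq.congr_right (funext fun j => ?_)
    simp only [σ, update_apply]
    split_ifs with h h' h'
    · omega
    · simp [hsb1, r, hv]
    · rw [h', hsb]
    · rfl
  have hbody : ∀ k t, (seq Pg (seq (drain (b + 1) []) (seq (drain (b + 2) [b + 1])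
      (op (some (.inc, b)))))).Sem (σ k) t ↔ True ∧ t = σ (k + 1) := by
    intro k t
    have e : (List.Vector.ofFn fun i => σ k ((Fin.cons b (Fin.cons (b + 1) fun i => xs i.succ) :
        Fin (n + 2) → ℕ) i)) = k ::ᵥ r k ::ᵥ v := by
      have e1 : σ k b = k := by simp [σ]
      have e2 : σ k (b + 1) = r k := by simp [σ]
      have e3 : (fun i : Fin n => σ k (xs i.succ)) = fun i => s (xs i.succ) := by
        funext i
        have := hx i.succ
        simp only [σ]
        rw [if_neg (by omega), if_neg (by omega)]
      rw [List.Vector.ofFn, List.Vector.ofFn]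
      simp only [Fin.cons_zero, Fin.cons_succ, e1, e2, e3, hv]
    have hg' : ∀ t, Pg.Sem (σ k) t ↔ t = update (σ k) (b + 2) (r (k + 1)) := by
      intro t
      rw [hg (σ k) fun j hj => ?_, e]
      · have e2 : σ k (b + 2) = 0 := by simp [σ, hsb2]
        rw [e2, zero_add]
      · simp only [σ]
        rw [if_neg (by omega), if_neg (by omega)]
        exact hs j (by omega)
    rw [sem_seq_of_left hg', sem_seq_of_left (sem_drain (by simp) _),
      sem_seq_of_left (sem_drain (by simp) _), true_and]
    simp only [Sem, CounterOp.Sem]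
    refine Eq.congr_right (funext fun j => ?_)
    simp only [σ, update_apply, List.not_mem_nil, List.mem_singleton, if_false]
    grind
  rw [sem_seq_of_left h1]
  -- `b + 2` is zero after each round and now receives a copy of the first argument for the
  -- comparison with `b`; a wrong guess has no execution.
  have hfin : ∀ k, (seq (add (xs 0) (b + 2) (b + 3)) (seq (test b (b + 2))
      (drain (b + 1) [y]))).Sem (σ k) s' ↔ k = s (xs 0) ∧ s' = update s y (s y + r k) := by
    intro k
    rw [sem_seq_of_left (sem_add (by omega) (by omega) (by omega) (by simp [σ, hsb3]))]
    have e0 : σ k (xs 0) = s (xs 0) := by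
      simp only [σ]
      rw [if_neg (by omega), if_neg (by omega)]
    have e2 : σ k (b + 2) = 0 := by simp [σ, hsb2]
    rw [e0, e2, zero_add, sem_seq_iff]
    simp only [sem_test (show b ≠ b + 2 by omega), and_assoc, exists_and_left,
      exists_eq_left]
    refine and_congr (by simp [σ]) ?_
    rw [sem_drain (by simp; omega)]
    refine Eq.congr_right (funext fun j => ?_)
    simp only [σ, update_apply, List.mem_singleton]
    grind
  rw [sem_seq_iff]
  simp only [sem_star σ (fun _ => True) hbody]
  constructor
  · rintro ⟨t, ⟨k, -, rfl⟩, ht⟩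
    obtain ⟨rfl, rfl⟩ := (hfin k).1 ht
    rfl
  · rintro rfl
    exact ⟨_, ⟨s (xs 0), fun _ _ => trivial, rfl⟩, (hfin _).2 ⟨rfl, rfl⟩⟩

/-- Subprograms receive a larger bound `b`, so their scratch counters cannot collide with values in
use. Target and arguments must differ because the arguments are drained and restored. -/
theorem exists_computes {n : ℕ} {f : List.Vector ℕ n → ℕ} (hf : Nat.Primrec' f) :
    ∀ (xs : Fin n → ℕ) (y b : ℕ), (∀ i, xs i < b ∧ xs i ≠ y) → y < b →
      ∃ P : Prog, P.Computes f xs y b := by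
  induction hf with
  | zero =>
    intro xs y b _ _
    exact ⟨op none, fun s _ s' => by simp [Sem, CounterOp.Sem]⟩
  | succ =>
    intro xs y b hx hy
    refine ⟨seq (add (xs 0) y b) (op (some (.inc, y))), fun s hs s' => ?_⟩
    rw [sem_seq_of_left (sem_add (hx 0).2 (hx 0).1.ne hy.ne (hs b le_rfl))]
    simp [Sem, CounterOp.Sem, List.Vector.ofFn, add_assoc]
  | get i =>
    intro xs y b hx hy
    refine ⟨add (xs i) y b, fun s hs s' => ?_⟩
    rw [sem_add (hx i).2 (hx i).1.ne hy.ne (hs b le_rfl)]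
    simp only [List.Vector.get_ofFn]
  | @comp m n f g _ _ ihf ihg =>
    intro xs y b hx hy
    obtain ⟨Pf, hPf⟩ := ihf (fun i => b + i) y (b + n) (fun i => ⟨by omega, by omega⟩) (by omega)
    choose Pg hPg using fun i => ihg i xs (b + i) (b + n)
      (fun j => ⟨by have := (hx j).1; omega, by have := (hx j).1; omega⟩) (by omega)
    exact exists_computes_comp g xs y b (fun i => (hx i).1) hy hPf hPg
  | prec _ _ ihf ihg =>
    intro xs y b hx hy
    obtain ⟨Pf, hPf⟩ := ihf (fun i => xs i.succ) (b + 1) (b + 3)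
      (fun i => by have := (hx i.succ).1; omega) (by omega)
    obtain ⟨Pg, hPg⟩ := ihg (Fin.cons b (Fin.cons (b + 1) fun i => xs i.succ)) (b + 2) (b + 3)
      (fun i => by
        refine Fin.cases ?_ (fun i => Fin.cases ?_ (fun i => ?_) i) i
        · simp
        · simp
        · have := (hx i.succ).1
          simp only [Fin.cons_succ]
          omega) (by omega)
    exact exists_computes_prec xs y b hx hy hPf hPg

/-- Every recursively enumerable set is the set of the values of counter `0` for which some program has an
execution, the other counters being zero. -/
theorem exists_of_rePred {q : ℕ → Prop} (hq : REPred q) :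
    ∃ P : Prog, ∀ n, q n ↔ ∃ s', P.Sem (update (fun _ => 0) 0 n) s' := by
  -- A partial function with domain `q` and constant value `0`.
  have hp : Nat.Partrec fun n => (Part.assert (q n) fun _ => Part.some ()).map fun _ => 0 := by
    refine Partrec.nat_iff.1 ?_
    exact Partrec.map hq (Computable.const 0).to₂
  obtain ⟨c, hc⟩ := Nat.Partrec.Code.exists_code.1 hp
  have hprim : Primrec fun v : List.Vector ℕ 2 =>
      if (Nat.Partrec.Code.evaln (v.get 0) c (v.get 1)).isSome then 0 else 1 := by
    refine Primrec.ite ?_ (Primrec.const 0) (Primrec.const 1)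
    refine Primrec.eq.comp (Primrec.option_isSome.comp ?_) (Primrec.const true)
    exact Nat.Partrec.Code.primrec_evaln.comp
      (((Primrec.vector_get.comp Primrec.id (Primrec.const 0)).pair (Primrec.const c)).pair
        (Primrec.vector_get.comp Primrec.id (Primrec.const 1)))
  obtain ⟨P, hP⟩ := exists_computes (Nat.Primrec'.of_prim hprim) ![1, 0] 2 3
    (by intro i; fin_cases i <;> simp) (by omega)
  -- Counter 1 guesses the step bound, and counter 2 receives `0` exactly if the code halts on
  -- counter 0 within that bound.
  refine ⟨seq (star (op (some (.inc, 1)))) (seq P (op (some (.ifzero, 2)))), fun n => ?_⟩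
  let σ : ℕ → ℕ → ℕ := fun k j => if j = 0 then n else if j = 1 then k else 0
  have h0 : update (fun _ => 0) 0 n = σ 0 := by
    funext j
    simp only [σ, update_apply]
    grind
  have hstar : ∀ t, (star (op (some (.inc, 1)))).Sem (σ 0) t ↔ ∃ k, (∀ j < k, True) ∧ t = σ k := by
    intro t
    refine sem_star σ (fun _ => True) fun k t => ?_
    simp only [Sem, CounterOp.Sem, true_and]
    refine Eq.congr_right (funext fun j => ?_)
    simp only [σ, update_apply]
    grind
  have hP' : ∀ k s', (seq P (op (some (.ifzero, 2)))).Sem (σ k) s' ↔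
      (Nat.Partrec.Code.evaln k c n).isSome ∧ s' = σ k := by
    intro k s'
    have hz : ∀ j, 3 ≤ j → σ k j = 0 := fun j hj => by
      simp only [σ]
      rw [if_neg (by omega), if_neg (by omega)]
    rw [sem_seq_of_left (hP (σ k) hz)]
    simp only [Sem, CounterOp.Sem, update_self, List.Vector.get_ofFn]
    have e1 : σ k (![1, 0] 0) = k := by simp [σ]
    have e2 : σ k (![1, 0] 1) = n := by simp [σ]
    have e3 : σ k 2 = 0 := by simp [σ]
    rw [e1, e2, e3, zero_add]
    by_cases h : (Nat.Partrec.Code.evaln k c n).isSome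
    · simp only [h, if_true, true_and]
      rw [← e3, update_eq_self]
    · simp [h]
  have hq' : q n ↔ ∃ k, (Nat.Partrec.Code.evaln k c n).isSome := by
    have : q n ↔ 0 ∈ c.eval n := by simp [hc, Part.mem_assert_iff]
    rw [this]
    constructor
    · intro h
      obtain ⟨k, hk⟩ := Nat.Partrec.Code.evaln_complete.1 h
      exact ⟨k, Option.isSome_iff_exists.2 ⟨_, hk⟩⟩
    · rintro ⟨k, hk⟩
      obtain ⟨a, ha⟩ := Option.isSome_iff_exists.1 hk
      have h1 := Nat.Partrec.Code.evaln_sound ha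
      have h2 : a = 0 := by
        rw [hc] at h1
        obtain ⟨_, -, rfl⟩ := (Part.mem_map_iff _).1 h1
        rfl
      exact h2 ▸ h1
  simp only [hq', h0, sem_seq_iff (P := star _), hstar]
  constructor
  · rintro ⟨k, hk⟩
    exact ⟨_, _, ⟨k, fun _ _ => trivial, rfl⟩, (hP' k _).2 ⟨hk, rfl⟩⟩
  · rintro ⟨s', t, ⟨k, -, rfl⟩, ht⟩
    exact ⟨k, ((hP' k _).1 ht).1⟩

end Prog

/-! ### Control graphs -/

/-- One step along an edge of a graph that is labelled with operations on counters. -/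
def GraphStep {S : Type} (E : List (S × CounterOp × S)) (x y : S × (ℕ → ℕ)) : Prop :=
  ∃ o : CounterOp, (x.1, o, y.1) ∈ E ∧ o.Sem x.2 y.2

theorem reflTransGen_graphStep_mono {S : Type} {E E' : List (S × CounterOp × S)} (h : E ⊆ E')
    {x y : S × (ℕ → ℕ)} (hxy : Relation.ReflTransGen (GraphStep E) x y) :
    Relation.ReflTransGen (GraphStep E') x y :=
  Relation.ReflTransGen.mono (fun _ _ ⟨o, h1, h2⟩ => ⟨o, h h1, h2⟩) _ _ hxy

namespace Prog

/-- The control graph of a program; its nodes are lists of programs that remain to be executed. -/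
def edges : Prog → List Prog → List (List Prog × CounterOp × List Prog)
  | op o, K => [(op o :: K, o, K)]
  | seq P Q, K => (seq P Q :: K, none, P :: Q :: K) :: (edges P (Q :: K) ++ edges Q K)
  | star P, K =>
    (star P :: K, none, K) :: (star P :: K, none, P :: star P :: K) :: edges P (star P :: K)

/-- The relation computed by a list of programs. -/
def listSem : List Prog → (ℕ → ℕ) → (ℕ → ℕ) → Prop
  | [], s, s' => s' = s
  | P :: K, s, s' => ∃ t, P.Sem s t ∧ listSem K t s'

/-- A node is a continuation: executing `P` leads from `P :: K` to `K`. Each round of a loop returns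
to the node `star P :: K`. -/
theorem reflTransGen_of_sem (P : Prog) : ∀ (K : List Prog) (s s' : ℕ → ℕ), P.Sem s s' →
    Relation.ReflTransGen (GraphStep (P.edges K)) (P :: K, s) (K, s') := by
  induction P with
  | op o => exact fun K s s' h => .single ⟨o, by simp [edges], h⟩
  | seq P Q ihP ihQ =>
    rintro K s s' ⟨t, h1, h2⟩
    refine .head (b := (P :: Q :: K, s)) ⟨none, by simp [edges], rfl⟩ (.trans
      (reflTransGen_graphStep_mono ?_ (ihP (Q :: K) s t h1))
      (reflTransGen_graphStep_mono ?_ (ihQ K t s' h2)))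
    · exact fun x hx => List.mem_cons_of_mem _ (List.mem_append_left _ hx)
    · exact fun x hx => List.mem_cons_of_mem _ (List.mem_append_right _ hx)
  | star P ih =>
    intro K s s' h
    induction h using Relation.ReflTransGen.head_induction_on with
    | refl => exact .single ⟨none, by simp [edges], rfl⟩
    | head h1 _ ih' =>
      refine .head (b := (P :: star P :: K, _)) ⟨none, by simp [edges], rfl⟩ (.trans
        (reflTransGen_graphStep_mono ?_ (ih (star P :: K) _ _ h1)) ih')
      exact fun x hx => List.mem_cons_of_mem _ (List.mem_cons_of_mem _ hx)

/-- Backward invariant: if the continuation at the target of an edge can lead to `u`, then so can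
the one at its source. Along a path to the empty list this recovers the meaning of the program. -/
theorem listSem_of_mem_edges (P : Prog) : ∀ (K : List Prog) (x : List Prog × CounterOp × List Prog),
    x ∈ P.edges K → ∀ s t u, x.2.1.Sem s t → listSem x.2.2 t u → listSem x.1 s u := by
  induction P with
  | op o =>
    intro K x hx s t u h1 h2
    obtain rfl := List.mem_singleton.1 hx
    exact ⟨t, h1, h2⟩
  | seq P Q ihP ihQ =>
    intro K x hx s t u h1 h2
    rcases List.mem_cons.1 hx with rfl | hx
    · obtain rfl : t = s := h1
      obtain ⟨t₁, h3, t₂, h4, h5⟩ := h2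
      exact ⟨t₂, ⟨t₁, h3, h4⟩, h5⟩
    · rcases List.mem_append.1 hx with hx | hx
      · exact ihP _ x hx s t u h1 h2
      · exact ihQ _ x hx s t u h1 h2
  | star P ih =>
    intro K x hx s t u h1 h2
    rcases List.mem_cons.1 hx with rfl | hx
    · obtain rfl : t = s := h1
      exact ⟨t, .refl, h2⟩
    · rcases List.mem_cons.1 hx with rfl | hx
      · obtain rfl : t = s := h1
        obtain ⟨t₁, h3, t₂, h4, h5⟩ := h2
        exact ⟨t₂, .head h3 h4, h5⟩
      · exact ih _ x hx s t u h1 h2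

theorem sem_iff_reflTransGen (P : Prog) (s s' : ℕ → ℕ) :
    P.Sem s s' ↔ Relation.ReflTransGen (GraphStep (P.edges [])) ([P], s) ([], s') := by
  refine ⟨reflTransGen_of_sem P [] s s', fun h => ?_⟩
  have key : ∀ x y : List Prog × (ℕ → ℕ), Relation.ReflTransGen (GraphStep (P.edges [])) x y →
      y = ([], s') → listSem x.1 x.2 s' := by
    intro x y h hy
    induction h using Relation.ReflTransGen.head_induction_on with
    | refl => subst hy; rfl
    | head h1 _ ih =>
      obtain ⟨o, h2, h3⟩ := h1
      exact listSem_of_mem_edges P [] _ h2 _ _ _ h3 ih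
  obtain ⟨t, h1, rfl⟩ := key _ _ h rfl
  exact h1

end Prog

theorem reflTransGen_graphStep_map {S S' : Type} {f : S → S'} (hf : Injective f)
    (E : List (S × CounterOp × S)) (a b : S) (s s' : ℕ → ℕ) :
    Relation.ReflTransGen (GraphStep (E.map fun e => (f e.1, e.2.1, f e.2.2))) (f a, s) (f b, s') ↔
      Relation.ReflTransGen (GraphStep E) (a, s) (b, s') := by
  constructor
  · intro h
    have key : ∀ y, Relation.ReflTransGen (GraphStep (E.map fun e => (f e.1, e.2.1, f e.2.2)))
        (f a, s) y → ∃ c, y.1 = f c ∧ Relation.ReflTransGen (GraphStep E) (a, s) (c, y.2) := by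
      intro y hy
      induction hy with
      | refl => exact ⟨a, rfl, .refl⟩
      | tail _ h1 ih =>
        obtain ⟨c, hc, hac⟩ := ih
        obtain ⟨o, h2, h3⟩ := h1
        obtain ⟨⟨e, o', e'⟩, he, heq⟩ := List.mem_map.1 h2
        simp only [Prod.mk.injEq, hc] at heq
        obtain ⟨h4, rfl, h5⟩ := heq
        obtain rfl := hf h4
        exact ⟨e', h5.symm, hac.tail ⟨o', he, h3⟩⟩
    obtain ⟨c, hc, h⟩ := key _ h
    obtain rfl := hf hc
    exact h
  · intro h
    refine Relation.ReflTransGen.lift (fun x : S × (ℕ → ℕ) => (f x.1, x.2)) ?_ _ _ h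
    rintro x y ⟨o, h1, h2⟩
    exact ⟨o, List.mem_map.2 ⟨_, h1, rfl⟩, h2⟩

/-- Every recursively enumerable set is accepted by a finite graph with operations on counters. -/
theorem exists_graph_of_rePred {q : ℕ → Prop} (hq : REPred q) :
    ∃ (E : List (ℕ × CounterOp × ℕ)) (a b : ℕ), ∀ n, q n ↔
      ∃ s', Relation.ReflTransGen (GraphStep E) (a, update (fun _ => 0) 0 n) (b, s') := by
  obtain ⟨P, hP⟩ := Prog.exists_of_rePred hq
  -- Any injective numbering of the nodes will do, computable or not: the graph depends on `q` only,
  -- not on the input.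
  obtain ⟨f, hf⟩ := exists_injective_nat (List Prog)
  refine ⟨(P.edges []).map fun e => (f e.1, e.2.1, f e.2.2), f [P], f [], fun n => ?_⟩
  simp only [hP, reflTransGen_graphStep_map hf, Prog.sem_iff_reflTransGen]

/-! ### The one-counter automaton that guesses an execution of a control graph -/

/-- The state in which the automaton moves its counter while the control graph is at node `s`. -/
def walkState (s : ℕ) : ℕ := 2 * s + 4

/-- The state that marks the execution of an operation (first component) leading to a node (second
component). -/
def markState (e : CounterOp × ℕ) : ℕ := 2 * Encodable.encode e + 5

theorem walkState_inj {s s' : ℕ} (h : walkState s = walkState s') : s = s' := by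
  simp only [walkState] at h
  omega

theorem markState_inj {e e' : CounterOp × ℕ} (h : markState e = markState e') : e = e' := by
  simp only [markState] at h
  exact Encodable.encode_injective (by omega)

theorem walkState_ne_markState (s : ℕ) (e : CounterOp × ℕ) : walkState s ≠ markState e := by
  simp only [walkState, markState]
  omega

theorem four_le_walkState (s : ℕ) : 4 ≤ walkState s := by
  simp only [walkState]
  omega

theorem four_le_markState (e : CounterOp × ℕ) : 4 ≤ markState e := by
  simp only [markState]
  omega

section Machine
variable (E : List (ℕ × CounterOp × ℕ)) (a b : ℕ)

/-- The nodes of a control graph with entry `a` and exit `b`. -/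
def graphNodes : List ℕ := a :: b :: (E.map (fun e => e.1) ++ E.map fun e => e.2.2)

/-- The automaton first climbs, in the states `0`, `1`, `2`, to the top value, which it reaches in state `3`.
Then it executes the operations of the control graph, each at a counter value of its choice. The steps in
state `1` stand for increments of counter `0`. -/
def graphAutomaton : OneCounterAutomaton where
  states := [0, 1, 2, 3] ++ (graphNodes E a b).map walkState ++ E.map fun e => markState e.2
  init := 0
  trans := [(0, .ifzero, 1), (0, .ifzero, 2), (1, .inc, 1), (1, .inc, 2), (2, .inc, 2), (2, .inc, 3),
      (3, .dec, walkState a)] ++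
    (graphNodes E a b).flatMap
      (fun s => [(walkState s, .inc, walkState s), (walkState s, .dec, walkState s)]) ++
    E.flatMap fun e => [(walkState e.1, .dec, markState e.2), (markState e.2, .inc, walkState e.2.2)]
  accept := [walkState b]

/-- The steps of `graphAutomaton`. -/
def GraphMove (x y : ℕ × ℕ) : Prop :=
  (x.1 = 0 ∧ (y.1 = 1 ∨ y.1 = 2) ∧ x.2 = 0 ∧ y.2 = 0) ∨
  (x.1 = 1 ∧ (y.1 = 1 ∨ y.1 = 2) ∧ y.2 = x.2 + 1) ∨
  (x.1 = 2 ∧ (y.1 = 2 ∨ y.1 = 3) ∧ y.2 = x.2 + 1) ∨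
  (x.1 = 3 ∧ y.1 = walkState a ∧ x.2 = y.2 + 1) ∨
  (∃ s ∈ graphNodes E a b, x.1 = walkState s ∧ y.1 = walkState s ∧
    (y.2 = x.2 + 1 ∨ x.2 = y.2 + 1)) ∨
  (∃ e ∈ E, x.1 = walkState e.1 ∧ y.1 = markState e.2 ∧ x.2 = y.2 + 1) ∨
  (∃ e ∈ E, x.1 = markState e.2 ∧ y.1 = walkState e.2.2 ∧ y.2 = x.2 + 1)

theorem step_graphAutomaton_iff (x y : ℕ × ℕ) :
    (graphAutomaton E a b).Step x y ↔ GraphMove E a b x y := by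
  simp only [OneCounterAutomaton.Step, graphAutomaton, List.mem_append, List.mem_cons,
    List.mem_flatMap, List.not_mem_nil, or_false, Prod.mk.injEq, reduceCtorEq, false_and,
    and_false, false_or, true_and, exists_false]
  constructor
  · rintro (⟨(h | ⟨s, hs, h⟩) | ⟨e, he, h⟩, h'⟩ | ⟨(h | ⟨s, hs, h⟩) | ⟨e, he, h⟩, h'⟩ | ⟨h, h'⟩)
    · unfold GraphMove
      omega
    · exact .inr (.inr (.inr (.inr (.inl ⟨s, hs, h.1, h.2, .inl h'⟩))))
    · exact .inr (.inr (.inr (.inr (.inr (.inr ⟨e, he, h.1, h.2, h'⟩)))))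
    · exact .inr (.inr (.inr (.inl ⟨h.1, h.2, h'⟩)))
    · exact .inr (.inr (.inr (.inr (.inl ⟨s, hs, h.1, h.2, .inr h'⟩))))
    · exact .inr (.inr (.inr (.inr (.inr (.inl ⟨e, he, h.1, h.2, h'⟩)))))
    · unfold GraphMove
      omega
  · rintro (h | h | h | h | ⟨s, hs, h1, h2, h3 | h3⟩ | ⟨e, he, h1, h2, h3⟩ | ⟨e, he, h1, h2, h3⟩)
    · exact .inr (.inr ⟨by omega, by omega⟩)
    · exact .inl ⟨.inl (.inl (by omega)), h.2.2⟩
    · exact .inl ⟨.inl (.inl (by omega)), h.2.2⟩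
    · exact .inr (.inl ⟨.inl (.inl ⟨h.1, h.2.1⟩), h.2.2⟩)
    · exact .inl ⟨.inl (.inr ⟨s, hs, h1, h2⟩), h3⟩
    · exact .inr (.inl ⟨.inl (.inr ⟨s, hs, h1, h2⟩), h3⟩)
    · exact .inr (.inl ⟨.inr ⟨e, he, h1, h2⟩, h3⟩)
    · exact .inl ⟨.inr ⟨e, he, h1, h2⟩, h3⟩

theorem source_mem_graphNodes {e : ℕ × CounterOp × ℕ} (he : e ∈ E) : e.1 ∈ graphNodes E a b := by
  simp only [graphNodes, List.mem_cons, List.mem_append, List.mem_map]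
  exact .inr (.inr (.inl ⟨e, he, rfl⟩))

theorem target_mem_graphNodes {e : ℕ × CounterOp × ℕ} (he : e ∈ E) : e.2.2 ∈ graphNodes E a b := by
  simp only [graphNodes, List.mem_cons, List.mem_append, List.mem_map]
  exact .inr (.inr (.inr ⟨e, he, rfl⟩))

theorem mem_states_graphAutomaton (q : ℕ) : q ∈ (graphAutomaton E a b).states ↔
    q ≤ 3 ∨ (∃ s ∈ graphNodes E a b, walkState s = q) ∨ ∃ e ∈ E, markState e.2 = q := by
  simp only [graphAutomaton, List.mem_append, List.mem_cons, List.not_mem_nil, or_false,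
    List.mem_map, or_assoc]
  rw [show q ≤ 3 ↔ q = 0 ∨ q = 1 ∨ q = 2 ∨ q = 3 by omega]
  simp only [or_assoc]

theorem wellFormed_graphAutomaton : (graphAutomaton E a b).WellFormed := by
  have hw {s} (hs : s ∈ graphNodes E a b) : walkState s ∈ (graphAutomaton E a b).states :=
    (mem_states_graphAutomaton E a b _).2 (.inr (.inl ⟨s, hs, rfl⟩))
  have hm {e} (he : e ∈ E) : markState e.2 ∈ (graphAutomaton E a b).states :=
    (mem_states_graphAutomaton E a b _).2 (.inr (.inr ⟨e, he, rfl⟩))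
  have hn (q : ℕ) (hq : q ≤ 3) : q ∈ (graphAutomaton E a b).states :=
    (mem_states_graphAutomaton E a b _).2 (.inl hq)
  refine ⟨hn 0 (by omega), ?_, ?_⟩
  · intro t ht
    simp only [graphAutomaton, List.mem_append, List.mem_cons, List.mem_flatMap, List.not_mem_nil,
      or_false] at ht
    rcases ht with (ht | ⟨s, hs, ht⟩) | ⟨e, he, ht⟩
    · rcases ht with rfl | rfl | rfl | rfl | rfl | rfl | rfl
      iterate 6 exact ⟨hn _ (by norm_num), hn _ (by norm_num)⟩
      exact ⟨hn _ (by norm_num), hw (by simp [graphNodes])⟩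
    · rcases ht with rfl | rfl
      · exact ⟨hw hs, hw hs⟩
      · exact ⟨hw hs, hw hs⟩
    · rcases ht with rfl | rfl
      · exact ⟨hw (source_mem_graphNodes E a b he), hm he⟩
      · exact ⟨hm he, hw (target_mem_graphNodes E a b he)⟩
  · intro q hq
    obtain rfl := List.mem_singleton.1 hq
    exact hw (by simp [graphNodes])

/-- The states that mark the instruction `i` on the counter `c`. -/
def marks (i : Instr) (c : ℕ) : List ℕ :=
  (if i = .inc ∧ c = 0 then [1] else []) ++
    (E.filter fun e => e.2.1 = some (i, c)).map fun e => markState e.2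

theorem mem_marks_iff {i : Instr} {c q : ℕ} : q ∈ marks E i c ↔
    (q = 1 ∧ i = .inc ∧ c = 0) ∨ ∃ e ∈ E, q = markState e.2 ∧ e.2.1 = some (i, c) := by
  simp only [marks, List.mem_append, List.mem_map, List.mem_filter, decide_eq_true_eq, and_assoc]
  refine or_congr ?_ (exists_congr fun e => by tauto)
  split_ifs with h
  · simp [h]
  · simp [h]

theorem walkState_notMem_marks (s : ℕ) (i : Instr) (c : ℕ) : walkState s ∉ marks E i c := by
  rw [mem_marks_iff]
  rintro (⟨h, -⟩ | ⟨e, -, h, -⟩)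
  · have := four_le_walkState s
    omega
  · exact walkState_ne_markState _ _ h

theorem markState_mem_marks_iff {e : ℕ × CounterOp × ℕ} (he : e ∈ E) (i : Instr) (c : ℕ) :
    markState e.2 ∈ marks E i c ↔ e.2.1 = some (i, c) := by
  rw [mem_marks_iff]
  constructor
  · rintro (⟨h, -⟩ | ⟨e', -, h, h'⟩)
    · have := four_le_markState e.2
      omega
    · rw [markState_inj h, h']
  · exact fun h => .inr ⟨e, he, rfl, h⟩

theorem mem_marks_of_le_three {q : ℕ} (hq : q ≤ 3) (i : Instr) (c : ℕ) :
    q ∈ marks E i c ↔ q = 1 ∧ i = .inc ∧ c = 0 := by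
  rw [mem_marks_iff]
  refine or_iff_left ?_
  rintro ⟨e, -, h, -⟩
  have := four_le_markState e.2
  omega

/-- A letter determines the operation that it marks: mark states encode it, and letter `1`, which
stands for increments of counter `0`, is below all mark states. -/
theorem eq_of_mem_marks {i i' : Instr} {c c' q : ℕ} (h : q ∈ marks E i c) (h' : q ∈ marks E i' c') :
    i = i' ∧ c = c' := by
  rw [mem_marks_iff] at h h'
  rcases h with ⟨rfl, rfl, rfl⟩ | ⟨e, he, rfl, h⟩
  · rcases h' with ⟨-, rfl, rfl⟩ | ⟨e, -, h, -⟩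
    · exact ⟨rfl, rfl⟩
    · have := four_le_markState e.2
      omega
  · rcases h' with ⟨h, -, -⟩ | ⟨e', he', h1, h2⟩
    · have := four_le_markState e.2
      omega
    · rw [markState_inj h1, h2] at h
      simp only [Option.some.injEq, Prod.mk.injEq] at h
      exact ⟨h.1.symm, h.2.symm⟩

theorem marks_subset_states (i : Instr) (c : ℕ) : marks E i c ⊆ (graphAutomaton E a b).states := by
  intro q hq
  rw [mem_states_graphAutomaton]
  rcases (mem_marks_iff E).1 hq with ⟨rfl, -⟩ | ⟨e, he, rfl, -⟩
  · exact .inl (by norm_num)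
  · exact .inr (.inr ⟨e, he, rfl⟩)

/-- The counters that occur in a control graph, and counter `0`. -/
def graphCounters : List ℕ := 0 :: E.filterMap fun e => e.2.1.map Prod.snd

theorem mem_graphCounters_of_mem_marks {i : Instr} {c q : ℕ} (h : q ∈ marks E i c) :
    c ∈ graphCounters E := by
  simp only [graphCounters, List.mem_cons, List.mem_filterMap]
  rcases (mem_marks_iff E).1 h with ⟨-, -, rfl⟩ | ⟨e, he, -, h⟩
  · exact .inl rfl
  · exact .inr ⟨e, he, by simp [h]⟩

/-! ### The conditions on runs that are expressed in the logic -/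

/-- The conditions on the run `g 0, …, g n` which ensure that it represents an execution of the control
graph from the store with the value `m` in counter `0`. -/
structure IsFaithful (g : ℕ → ℕ × ℕ) (n m : ℕ) : Prop where
  inc_ne : ∀ c i j, i < j → j ≤ n → (g i).1 ∈ marks E .inc c → (g j).1 ∈ marks E .inc c →
    (g i).2 ≠ (g j).2
  dec_ne : ∀ c i j, i < j → j ≤ n → (g i).1 ∈ marks E .dec c → (g j).1 ∈ marks E .dec c →
    (g i).2 ≠ (g j).2
  matched : ∀ c i k, i ≤ k → k ≤ n → (g i).1 ∈ [1, 2] → (g k).1 ∈ marks E .dec c →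
    (g i).2 = (g k).2 → ∃ j, i ≤ j ∧ (g j).1 ∈ marks E .inc c ∧ (g i).2 = (g j).2 ∧
      ∃ k', j ≤ k' ∧ k' ≤ n ∧ (g k').1 ∈ marks E .dec c ∧ (g i).2 = (g k').2
  used : ∀ c i k, i ≤ k → k ≤ n → (g i).1 ∈ marks E .inc c → (g k).1 ∈ marks E .ifzero c →
    ∃ j, i ≤ j ∧ j ≤ n ∧ (g j).1 ∈ marks E .dec c ∧ (g i).2 = (g j).2
  not_late : ∀ c i k j, i ≤ k → k ≤ j → j ≤ n → (g i).1 ∈ marks E .inc c →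
    (g k).1 ∈ marks E .ifzero c → (g j).1 ∈ marks E .dec c → (g i).2 ≠ (g j).2
  top_ne : ∀ i j, i < j → j ≤ n → (g i).1 = 3 → (g i).2 ≠ (g j).2
  input : m + 1 ≤ n ∧ (g (m + 1)).1 = 2 ∧ (g m).1 ≠ 2

end Machine

namespace Formula

/-- The current letter belongs to a list. -/
def anyOf (l : List ℕ) : Formula ℕ :=
  neg (l.foldr (fun q φ => and (neg (letter q)) φ) (neg (and (letter 0) (neg (letter 0)))))

/-- Positions with letters in `l` carry pairwise different data. -/
def distinct (l : List ℕ) : Formula ℕ :=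
  neg (F (and (anyOf l) (freeze 1 (X (F (and (anyOf l) (reg 1)))))))

/-- For the datum of a position with a letter in `P`, an occurrence with a letter in `D` implies an
occurrence with a letter in `I` that is followed by one with a letter in `D`. -/
def precededBy (P I D : List ℕ) : Formula ℕ :=
  neg (F (and (anyOf P) (freeze 1 (and (F (and (anyOf D) (reg 1)))
    (neg (F (and (and (anyOf I) (reg 1)) (F (and (anyOf D) (reg 1))))))))))

/-- The datum of a position with a letter in `I` that is followed by a letter in `Z` occurs later with a letter
in `D`. -/
def eventuallyUsed (I D Z : List ℕ) : Formula ℕ :=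
  neg (F (and (anyOf I) (freeze 1 (and (F (anyOf Z)) (neg (F (and (anyOf D) (reg 1))))))))

/-- The datum of a position with a letter in `I` does not occur with a letter in `D` after a letter in `Z`. -/
def neverUsedAfter (I D Z : List ℕ) : Formula ℕ :=
  neg (F (and (anyOf I) (freeze 1 (F (and (anyOf Z) (F (and (anyOf D) (reg 1))))))))

/-- The datum of a position with a letter in `l` does not occur again. -/
def notRepeated (l : List ℕ) : Formula ℕ :=
  neg (F (and (anyOf l) (freeze 1 (X (F (reg 1))))))

/-- The letters at positions `m` and `m + 1` are outside and in `l`, respectively. -/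
def entersAt (l : List ℕ) (m : ℕ) : Formula ℕ :=
  and (X^[m + 1] (anyOf l)) (X^[m] (neg (anyOf l)))

end Formula

/-- The conditions that concern the counter `c`. -/
def counterFormula (E : List (ℕ × CounterOp × ℕ)) (c : ℕ) : Formula ℕ :=
  .and (.distinct (marks E .inc c)) (.and (.distinct (marks E .dec c))
    (.and (.precededBy [1, 2] (marks E .inc c) (marks E .dec c))
      (.and (.eventuallyUsed (marks E .inc c) (marks E .dec c) (marks E .ifzero c))
        (.neverUsedAfter (marks E .inc c) (marks E .dec c) (marks E .ifzero c)))))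

/-- The conditions that do not depend on the input. -/
def graphFormula (E : List (ℕ × CounterOp × ℕ)) : Formula ℕ :=
  (graphCounters E).foldr (fun c φ => .and (counterFormula E c) φ) (.notRepeated [3])

/-! ### Translation of the formulae into conditions on positions -/

/-- The sequence `g 0, …, g n` as a data word. -/
def wordOf (g : ℕ → ℕ × ℕ) (n : ℕ) : FiniteDataWord ℕ where
  length := n + 1
  length_pos := Nat.succ_pos _
  letter i := (g i).1
  sim := Setoid.ker fun i : Fin (n + 1) => (g i).2

/-- Satisfaction at position `i` of the word `g 0, …, g n`. -/
def SatAt (g : ℕ → ℕ × ℕ) (n : ℕ) (v : ℕ+ → Option (Fin (n + 1))) (i : ℕ) (hi : i < n + 1)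
    (φ : Formula ℕ) : Prop :=
  (wordOf g n).Sat v ⟨i, hi⟩ φ

section Semantics
variable {g : ℕ → ℕ × ℕ} {n : ℕ} (v : ℕ+ → Option (Fin (n + 1))) (i : ℕ) (hi : i < n + 1)

theorem satAt_letter (q : ℕ) : SatAt g n v i hi (.letter q) ↔ (g i).1 = q := Iff.rfl

theorem satAt_and (φ ψ : Formula ℕ) : SatAt g n v i hi (.and φ ψ) ↔
    SatAt g n v i hi φ ∧ SatAt g n v i hi ψ := Iff.rfl

theorem satAt_neg (φ : Formula ℕ) : SatAt g n v i hi (.neg φ) ↔ ¬ SatAt g n v i hi φ := Iff.rfl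

theorem satAt_anyOf (l : List ℕ) : SatAt g n v i hi (.anyOf l) ↔ (g i).1 ∈ l := by
  rw [Formula.anyOf, satAt_neg, not_iff_comm]
  induction l with
  | nil => simp [satAt_neg, satAt_and]
  | cons q l ih =>
    rw [List.foldr_cons, satAt_and, ← ih, satAt_neg, satAt_letter, List.mem_cons, not_or]

theorem satAt_F (φ : Formula ℕ) : SatAt g n v i hi (.F φ) ↔
    ∃ j, ∃ hj : j < n + 1, i ≤ j ∧ SatAt g n v j hj φ :=
  Fin.exists_iff

theorem satAt_XF (φ : Formula ℕ) : SatAt g n v i hi (.X (.F φ)) ↔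
    ∃ j, ∃ hj : j < n + 1, i < j ∧ SatAt g n v j hj φ := by
  constructor
  · rintro ⟨h, j, hj, hφ⟩
    exact ⟨j, j.2, hj, hφ⟩
  · rintro ⟨j, hj, hij, hφ⟩
    exact ⟨lt_of_le_of_lt (Nat.succ_le_of_lt hij) hj, ⟨j, hj⟩, Nat.succ_le_of_lt hij, hφ⟩

theorem satAt_freeze (φ : Formula ℕ) : SatAt g n v i hi (.freeze 1 φ) ↔
    SatAt g n (update v 1 (some ⟨i, hi⟩)) i hi φ := Iff.rfl

theorem satAt_reg (k : ℕ) (hk : k < n + 1) :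
    SatAt g n (update v 1 (some ⟨k, hk⟩)) i hi (.reg 1) ↔ (g k).2 = (g i).2 := by
  have h : update v 1 (some ⟨k, hk⟩) 1 = some (⟨k, hk⟩ : Fin (n + 1)) := update_self _ _ _
  constructor
  · rintro ⟨k', h1, h2⟩
    obtain rfl := Option.some.inj (h.symm.trans h1)
    exact h2
  · exact fun h' => ⟨_, h, h'⟩

theorem satAt_iterate_X (φ : Formula ℕ) (k : ℕ) :
    SatAt g n v i hi (Formula.X^[k] φ) ↔ ∃ h : i + k < n + 1, SatAt g n v (i + k) h φ := by
  induction k generalizing i with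
  | zero => exact ⟨fun h => ⟨hi, h⟩, fun ⟨_, h⟩ => h⟩
  | succ k ih =>
    rw [Function.iterate_succ_apply']
    have e : i + (k + 1) = i + 1 + k := by omega
    constructor
    · rintro ⟨h, h'⟩
      obtain ⟨h1, h2⟩ := (ih (i + 1) h).1 h'
      refine ⟨by omega, ?_⟩
      simpa only [e] using h2
    · rintro ⟨h, h'⟩
      refine ⟨show i + 1 < n + 1 by omega, (ih (i + 1) (by omega)).2 ⟨by omega, ?_⟩⟩
      simpa only [e] using h'

end Semantics

/-- The formula is a finite conjunction over `graphCounters E`, whereas `IsFaithful` speaks of all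
counters. For the others the conditions are vacuous, as each assumes a letter that marks the
counter. -/
theorem models_wordOf_iff (E : List (ℕ × CounterOp × ℕ)) (g : ℕ → ℕ × ℕ) (n m : ℕ) :
    (wordOf g n).Models (.and (graphFormula E) (.entersAt [2] m)) ↔ IsFaithful E g n m := by
  let v : ℕ+ → Option (Fin (n + 1)) := fun _ => none
  have hg : SatAt g n v 0 n.succ_pos (graphFormula E) ↔
      (∀ c ∈ graphCounters E, SatAt g n v 0 n.succ_pos (counterFormula E c)) ∧
        SatAt g n v 0 n.succ_pos (.notRepeated [3]) := by
    rw [graphFormula]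
    induction graphCounters E with
    | nil => simp
    | cons c l ih =>
      rw [List.foldr_cons, satAt_and, ih, List.forall_mem_cons, and_assoc]
  have hmodels : (wordOf g n).Models (.and (graphFormula E) (.entersAt [2] m)) ↔
      SatAt g n v 0 n.succ_pos (graphFormula E) ∧
        SatAt g n v 0 n.succ_pos (.entersAt [2] m) := Iff.rfl
  have hinput : SatAt g n v 0 n.succ_pos (.entersAt [2] m) ↔
      m + 1 ≤ n ∧ (g (m + 1)).1 = 2 ∧ (g m).1 ≠ 2 := by
    rw [Formula.entersAt, satAt_and, satAt_iterate_X, satAt_iterate_X]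
    simp only [satAt_anyOf, satAt_neg, zero_add, List.mem_singleton]
    constructor
    · rintro ⟨⟨h1, h2⟩, h3, h4⟩
      exact ⟨by omega, h2, h4⟩
    · rintro ⟨h1, h2, h3⟩
      exact ⟨⟨by omega, h2⟩, by omega, h3⟩
  have htop : SatAt g n v 0 n.succ_pos (.notRepeated [3]) ↔
      ∀ i j, i < j → j ≤ n → (g i).1 = 3 → (g i).2 ≠ (g j).2 := by
    simp only [Formula.notRepeated, satAt_anyOf, satAt_neg, satAt_F, satAt_XF,
      satAt_and, satAt_freeze, satAt_reg, List.mem_singleton]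
    constructor
    · intro h i j h1 h2 h3 h4
      exact h ⟨i, by omega, by omega, h3, j, by omega, h1, h4⟩
    · rintro h ⟨i, h1, -, h3, j, h4, h5, h6⟩
      exact h i j h5 (by omega) h3 h6
  have hcounter (c : ℕ) : SatAt g n v 0 n.succ_pos (counterFormula E c) ↔
    (∀ i j, i < j → j ≤ n → (g i).1 ∈ marks E .inc c → (g j).1 ∈ marks E .inc c →
      (g i).2 ≠ (g j).2) ∧
    (∀ i j, i < j → j ≤ n → (g i).1 ∈ marks E .dec c → (g j).1 ∈ marks E .dec c →
      (g i).2 ≠ (g j).2) ∧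
    (∀ i k, i ≤ k → k ≤ n → (g i).1 ∈ [1, 2] → (g k).1 ∈ marks E .dec c →
      (g i).2 = (g k).2 → ∃ j, i ≤ j ∧ (g j).1 ∈ marks E .inc c ∧ (g i).2 = (g j).2 ∧
        ∃ k', j ≤ k' ∧ k' ≤ n ∧ (g k').1 ∈ marks E .dec c ∧ (g i).2 = (g k').2) ∧
    (∀ i k, i ≤ k → k ≤ n → (g i).1 ∈ marks E .inc c → (g k).1 ∈ marks E .ifzero c →
      ∃ j, i ≤ j ∧ j ≤ n ∧ (g j).1 ∈ marks E .dec c ∧ (g i).2 = (g j).2) ∧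
    (∀ i k j, i ≤ k → k ≤ j → j ≤ n → (g i).1 ∈ marks E .inc c →
      (g k).1 ∈ marks E .ifzero c → (g j).1 ∈ marks E .dec c → (g i).2 ≠ (g j).2) := by
    simp only [counterFormula, Formula.distinct, Formula.precededBy, Formula.eventuallyUsed,
      Formula.neverUsedAfter, satAt_anyOf, satAt_neg, satAt_F, satAt_XF,
      satAt_and, satAt_freeze, satAt_reg]
    have hdist (l : List ℕ) : (¬ ∃ i, ∃ _ : i < n + 1, 0 ≤ i ∧ (g i).1 ∈ l ∧
        ∃ j, ∃ _ : j < n + 1, i < j ∧ (g j).1 ∈ l ∧ (g i).2 = (g j).2) ↔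
        ∀ i j, i < j → j ≤ n → (g i).1 ∈ l → (g j).1 ∈ l → (g i).2 ≠ (g j).2 := by
      constructor
      · intro h i j h1 h2 h3 h4 h5
        exact h ⟨i, by omega, by omega, h3, j, by omega, h1, h4, h5⟩
      · rintro h ⟨i, h1, -, h3, j, h4, h5, h6, h7⟩
        exact h i j h5 (by omega) h3 h6 h7
    refine and_congr (hdist _) (and_congr (hdist _) (and_congr ?_ (and_congr ?_ ?_)))
    · constructor
      · intro h i k h1 h2 h3 h4 h5
        by_contra hcon
        refine h ⟨i, by omega, by omega, h3, ⟨k, by omega, h1, h4, h5⟩, ?_⟩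
        rintro ⟨j, hj, h6, ⟨h7, h8⟩, k', hk', h9, h10, h11⟩
        exact hcon ⟨j, h6, h7, h8, k', h9, by omega, h10, h11⟩
      · rintro h ⟨i, hi, -, h3, ⟨k, hk, h4, h5, h6⟩, h7⟩
        obtain ⟨j, h8, h9, h10, k', h11, h12, h13, h14⟩ := h i k h4 (by omega) h3 h5 h6
        exact h7 ⟨j, by omega, h8, ⟨h9, h10⟩, k', by omega, h11, h13, h14⟩
    · constructor
      · intro h i k h1 h2 h3 h4
        by_contra hcon
        refine h ⟨i, by omega, by omega, h3, ⟨k, by omega, h1, h4⟩, ?_⟩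
        rintro ⟨j, hj, h6, h7, h8⟩
        exact hcon ⟨j, h6, by omega, h7, h8⟩
      · rintro h ⟨i, hi, -, h3, ⟨k, hk, h4, h5⟩, h7⟩
        obtain ⟨j, h8, h9, h10, h11⟩ := h i k h4 (by omega) h3 h5
        exact h7 ⟨j, by omega, h8, h10, h11⟩
    · constructor
      · intro h i k j h1 h2 h3 h4 h5 h6 h7
        exact h ⟨i, by omega, by omega, h4, k, by omega, h1, h5, j, by omega, h2, h6, h7⟩
      · rintro h ⟨i, hi, -, h3, k, hk, h4, h5, j, hj, h6, h7, h8⟩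
        exact h i k j h4 h6 (by omega) h3 h5 h7 h8
  rw [hmodels, hg, hinput, htop]
  simp only [hcounter]
  constructor
  · rintro ⟨⟨h1, h2⟩, h3⟩
    exact {
      inc_ne := fun c i j hij hj hi' => (h1 c (mem_graphCounters_of_mem_marks E hi')).1 i j hij hj hi'
      dec_ne := fun c i j hij hj hi' =>
        (h1 c (mem_graphCounters_of_mem_marks E hi')).2.1 i j hij hj hi'
      matched := fun c i k hik hk hi' hk' =>
        (h1 c (mem_graphCounters_of_mem_marks E hk')).2.2.1 i k hik hk hi' hk'
      used := fun c i k hik hk hi' =>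
        (h1 c (mem_graphCounters_of_mem_marks E hi')).2.2.2.1 i k hik hk hi'
      not_late := fun c i k j hik hkj hj hi' =>
        (h1 c (mem_graphCounters_of_mem_marks E hi')).2.2.2.2 i k j hik hkj hj hi'
      top_ne := h2
      input := h3 }
  · intro h
    exact ⟨⟨fun c _ => ⟨h.inc_ne c, h.dec_ne c, h.matched c, h.used c, h.not_late c⟩, h.top_ne⟩,
      h.input⟩

/-! ### Faithful runs represent executions -/

section Runs
variable {E : List (ℕ × CounterOp × ℕ)} {a b : ℕ}

/-- What the numbering of states is made for: the climb uses the letters up to `3`, it is left only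
through `3`, and it is never re-entered. -/
theorem GraphMove.spec {x y : ℕ × ℕ} (h : GraphMove E a b x y) :
    (y.1 ≤ 3 → x.1 ≤ 2 ∧ y.1 ≠ 0 ∧ (x.1 = 0 → y.2 = 0) ∧ (x.1 ≠ 0 → y.2 = x.2 + 1) ∧
      (y.1 = 1 → x.1 ≤ 1) ∧ (x.1 = 2 → 2 ≤ y.1)) ∧
    (x.1 ≤ 2 → y.1 ≤ 3) ∧ (x.1 = 3 → y.1 = walkState a) ∧ (3 ≤ x.1 → 4 ≤ y.1) ∧
    (x.1 = 3 → x.2 = y.2 + 1) ∧ y.2 ≤ x.2 + 1 := by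
  rcases h with h | h | h | h | ⟨s, hs, h1, h2, h3⟩ | ⟨e, he, h1, h2, h3⟩ | ⟨e, he, h1, h2, h3⟩
  · omega
  · omega
  · omega
  · have := four_le_walkState a
    omega
  · have := four_le_walkState s
    omega
  · have := four_le_walkState e.1
    have := four_le_markState e.2
    omega
  · have := four_le_walkState e.2.2
    have := four_le_markState e.2
    omega

variable (E a b) in
/-- The sequence `g 0, …, g n` is a run of `graphAutomaton E a b`. -/
structure IsGraphRun (g : ℕ → ℕ × ℕ) (n : ℕ) : Prop where
  start : g 0 = (0, 0)
  step : ∀ i < n, GraphMove E a b (g i) (g (i + 1))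

variable {g : ℕ → ℕ × ℕ} {n : ℕ}

namespace IsGraphRun

theorem shape (h : IsGraphRun E a b g n) {i : ℕ} (hi : i ≤ n) (hs : (g i).1 ≤ 3) :
    ((g i).1 = 0 → i = 0) ∧ ((g i).1 ≠ 0 → (g i).2 + 1 = i) ∧ ∀ j < i, (g j).1 ≤ 2 := by
  induction i with
  | zero => simp [h.start]
  | succ i ih =>
    have hm := (h.step i hi).spec.1 hs
    have ih' := ih (by omega) (by omega)
    refine ⟨fun h0 => absurd h0 hm.2.1, fun _ => ?_, fun j hj => ?_⟩
    · by_cases h0 : (g i).1 = 0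
      · have := hm.2.2.1 h0
        have := ih'.1 h0
        omega
      · have := hm.2.2.2.1 h0
        have := ih'.2.1 h0
        omega
    · rcases Nat.lt_succ_iff_lt_or_eq.1 hj with hj | rfl
      · exact ih'.2.2 j hj
      · exact hm.1

theorem exists_top (h : IsGraphRun E a b g n) {i : ℕ} (hi : i ≤ n) (hs : 4 ≤ (g i).1) :
    ∃ t < i, (g t).1 = 3 := by
  induction i with
  | zero => simp [h.start] at hs
  | succ i ih =>
    have hm := (h.step i hi).spec
    by_cases h3 : (g i).1 = 3
    · exact ⟨i, by omega, h3⟩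
    · obtain ⟨t, ht, h'⟩ := ih (by omega) (by omega)
      exact ⟨t, by omega, h'⟩

theorem after_top (h : IsGraphRun E a b g n) {t j : ℕ} (ht : (g t).1 = 3) (htj : t < j)
    (hj : j ≤ n) : 4 ≤ (g j).1 := by
  induction j with
  | zero => omega
  | succ j ih =>
    have hm := (h.step j hj).spec
    rcases Nat.lt_succ_iff_lt_or_eq.1 htj with htj | rfl
    · have := ih htj (by omega)
      omega
    · omega

theorem before_top (h : IsGraphRun E a b g n) {t j : ℕ} (ht : (g t).1 = 3) (htn : t ≤ n)
    (h1 : 1 ≤ j) (hj : j < t) : ((g j).1 = 1 ∨ (g j).1 = 2) ∧ (g j).2 + 1 = j := by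
  have h2 := (h.shape htn (by omega)).2.2 j hj
  have h3 := h.shape (i := j) (by omega) (by omega)
  have h4 : (g j).1 ≠ 0 := fun h0 => by
    have := h3.1 h0
    omega
  exact ⟨by omega, h3.2.1 h4⟩

theorem top_val (h : IsGraphRun E a b g n) {t : ℕ} (ht : (g t).1 = 3) (htn : t ≤ n) :
    (g t).2 + 1 = t :=
  (h.shape htn (by omega)).2.1 (by omega)

end IsGraphRun

/-! ### Counting marks -/

/-- If the values at `P`-positions are pairwise different and all occur at `Q`-positions, then there are at most as
many `P`-positions as `Q`-positions. -/
theorem count_le_count_of_values {P Q : ℕ → Prop} [DecidablePred P] [DecidablePred Q] (val : ℕ → ℕ)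
    {p p' : ℕ} (h1 : ∀ i < p, P i → ∃ j < p', Q j ∧ val i = val j)
    (h2 : ∀ i j, i < j → j < p → P i → P j → val i ≠ val j) : Nat.count P p ≤ Nat.count Q p' := by
  rw [Nat.count_eq_card_filter_range, Nat.count_eq_card_filter_range]
  have h3 : ∀ i ∈ (Finset.range p).filter P, ∃ j ∈ (Finset.range p').filter Q, val i = val j := by
    intro i hi
    rw [Finset.mem_filter, Finset.mem_range] at hi
    obtain ⟨j, h4, h5, h6⟩ := h1 i hi.1 hi.2
    exact ⟨j, by simp [h4, h5], h6⟩
  choose! f hf hval using h3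
  refine Finset.card_le_card_of_injOn f hf fun i hi j hj hij => ?_
  have hv : val i = val j := by rw [hval i hi, hval j hj, hij]
  rw [Finset.mem_coe, Finset.mem_filter, Finset.mem_range] at hi hj
  rcases lt_trichotomy i j with h | h | h
  · exact absurd hv (h2 i j h hj.1 hi.2 hj.2)
  · exact h
  · exact absurd hv.symm (h2 j i h hi.1 hj.2 hi.2)

/-- The number of positions before `p` that mark the instruction `i` on the counter `c`. -/
def countMarks (E : List (ℕ × CounterOp × ℕ)) (g : ℕ → ℕ × ℕ) (i : Instr) (c p : ℕ) : ℕ :=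
  Nat.count (fun j => (g j).1 ∈ marks E i c) p

theorem countMarks_succ (i : Instr) (c p : ℕ) : countMarks E g i c (p + 1) =
    countMarks E g i c p + if (g p).1 ∈ marks E i c then 1 else 0 :=
  Nat.count_succ _ _

/-- The store that is represented at position `p`. -/
def storeAt (E : List (ℕ × CounterOp × ℕ)) (g : ℕ → ℕ × ℕ) (p c : ℕ) : ℕ :=
  countMarks E g .inc c p - countMarks E g .dec c p

namespace IsFaithful
variable {m : ℕ}

/-- The run leaves the top downwards and the value rises by at most one per step, so it could exceed
the top only by passing through it again, which `top_ne` forbids. -/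
theorem lt_top (hf : IsFaithful E g n m) (h : IsGraphRun E a b g n) {t j : ℕ} (ht : (g t).1 = 3)
    (htj : t < j) (hj : j ≤ n) : (g j).2 < (g t).2 := by
  induction j with
  | zero => omega
  | succ j ih =>
    have hm := (h.step j hj).spec
    have hne := hf.top_ne t (j + 1) htj hj ht
    rcases Nat.lt_succ_iff_lt_or_eq.1 htj with htj | rfl
    · have := ih htj (by omega)
      omega
    · have := hm.2.2.2.2.1 ht
      omega

/-- The value at `i` is below the top, so it occurs in the climb. From there `matched` gives an
increment followed by a decrement at the same value; by `dec_ne` this decrement is the one at `i`.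
-/
theorem exists_inc_before (hf : IsFaithful E g n m) (h : IsGraphRun E a b g n) {c i : ℕ}
    (hi : i ≤ n) (hd : (g i).1 ∈ marks E .dec c) :
    ∃ j < i, (g j).1 ∈ marks E .inc c ∧ (g i).2 = (g j).2 := by
  have h4 : 4 ≤ (g i).1 := by
    by_contra hlt
    have := (mem_marks_of_le_three E (by omega) _ _).1 hd
    simp at this
  obtain ⟨t, hti, ht⟩ := h.exists_top hi h4
  have hlt := hf.lt_top h ht hti hi
  have htv := h.top_val ht (by omega)
  -- The climb has value `v` at position `v + 1`.
  obtain ⟨h5, h6⟩ := h.before_top ht (by omega) (j := (g i).2 + 1) (by omega) (by omega)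
  have h7 : (g ((g i).2 + 1)).2 = (g i).2 := by omega
  obtain ⟨j, h8, h9, h10, k', h11, h12, h13, h14⟩ :=
    hf.matched c ((g i).2 + 1) i (by omega) hi (by simpa using h5) hd h7
  have hk : k' = i := by
    rcases lt_trichotomy k' i with h' | h' | h'
    · exact absurd (h14.symm.trans h7) (hf.dec_ne c _ _ h' hi h13 hd)
    · exact h'
    · exact absurd (h7.symm.trans h14) (hf.dec_ne c _ _ h' h12 hd h13)
  have hj : j ≠ i := by
    rintro rfl
    exact absurd (eq_of_mem_marks E h9 hd).1 (by simp)
  exact ⟨j, by omega, h9, h7.symm.trans h10⟩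

theorem countMarks_dec_le (hf : IsFaithful E g n m) (h : IsGraphRun E a b g n) (c : ℕ) {p : ℕ}
    (hp : p ≤ n + 1) : countMarks E g .dec c p ≤ countMarks E g .inc c p := by
  refine count_le_count_of_values (fun i => (g i).2) (fun i hi hd => ?_)
    fun i j hij hj hi' hj' => hf.dec_ne c i j hij (by omega) hi' hj'
  obtain ⟨j, h1, h2, h3⟩ := hf.exists_inc_before h (by omega) hd
  exact ⟨j, by omega, h2, h3⟩

/-- The decrement at `p` itself is included in the comparison: its matching increment also lies
strictly before `p`. -/
theorem countMarks_dec_lt (hf : IsFaithful E g n m) (h : IsGraphRun E a b g n) {c p : ℕ}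
    (hp : p ≤ n) (hd : (g p).1 ∈ marks E .dec c) :
    countMarks E g .dec c p < countMarks E g .inc c p := by
  have : countMarks E g .dec c (p + 1) ≤ countMarks E g .inc c p := by
    refine count_le_count_of_values (fun i => (g i).2) (fun i hi hd' => ?_)
      fun i j hij hj hi' hj' => hf.dec_ne c i j hij (by omega) hi' hj'
    obtain ⟨j, h1, h2, h3⟩ := hf.exists_inc_before h (by omega) hd'
    exact ⟨j, by omega, h2, h3⟩
  rw [countMarks_succ, if_pos hd] at this
  exact this

/-- Each increment before the test has a decrement at its value by `used`, and `not_late` moves this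
decrement before the test. -/
theorem countMarks_inc_le (hf : IsFaithful E g n m) {c p : ℕ} (hp : p ≤ n)
    (hz : (g p).1 ∈ marks E .ifzero c) : countMarks E g .inc c p ≤ countMarks E g .dec c p := by
  refine count_le_count_of_values (fun i => (g i).2) (fun i hi hi' => ?_)
    fun i j hij hj hi' hj' => hf.inc_ne c i j hij (by omega) hi' hj'
  obtain ⟨j, h1, h2, h3, h4⟩ := hf.used c i p hi.le hp hi' hz
  refine ⟨j, ?_, h3, h4⟩
  by_contra hlt
  exact hf.not_late c i p j hi.le (by omega) h2 hi' hz h3 h4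

/-- The preceding inequalities between counts make the truncated subtraction in `storeAt` genuine
and give the guards of decrements and zero tests. -/
theorem sem_storeAt (hf : IsFaithful E g n m) (h : IsGraphRun E a b g n) {e : ℕ × CounterOp × ℕ}
    (he : e ∈ E) {p : ℕ} (hp : p ≤ n) (hg : (g p).1 = markState e.2) :
    e.2.1.Sem (storeAt E g p) (storeAt E g (p + 1)) := by
  have hmark (i : Instr) (c : ℕ) : (g p).1 ∈ marks E i c ↔ e.2.1 = some (i, c) := by
    rw [hg, markState_mem_marks_iff E he]
  have hst (c : ℕ) : storeAt E g (p + 1) c =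
      (countMarks E g .inc c p + if e.2.1 = some (.inc, c) then 1 else 0) -
        (countMarks E g .dec c p + if e.2.1 = some (.dec, c) then 1 else 0) := by
    simp only [storeAt, countMarks_succ, hmark]
  match ho : e.2.1 with
  | none =>
    funext c
    rw [hst, ho]
    simp [storeAt]
  | some (.inc, c) =>
    funext c'
    have := hf.countMarks_dec_le h c (p := p) (by omega)
    rw [hst, update_apply, ho]
    by_cases hc : c' = c
    · subst hc
      simp [storeAt]
      omega
    · simp [storeAt, hc, Ne.symm hc]
  | some (.dec, c) =>
    have := hf.countMarks_dec_lt h hp ((hmark .dec c).2 ho)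
    refine ⟨by simp only [storeAt]; omega, funext fun c' => ?_⟩
    rw [hst, update_apply, ho]
    by_cases hc : c' = c
    · subst hc
      simp [storeAt]
      omega
    · simp [storeAt, hc, Ne.symm hc]
  | some (.ifzero, c) =>
    have := hf.countMarks_inc_le hp ((hmark .ifzero c).2 ho)
    refine ⟨by simp only [storeAt]; omega, funext fun c' => ?_⟩
    rw [hst, ho]
    simp [storeAt]

/-- `input` fixes the point where the climb changes from state `1` to state `2`: positions `1, …, m`
have letter `1`, and the rest of the climb marks nothing. -/
theorem storeAt_top (hf : IsFaithful E g n m) (h : IsGraphRun E a b g n) {t : ℕ} (ht : (g t).1 = 3)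
    (htn : t ≤ n) : storeAt E g (t + 1) = update (fun _ => 0) 0 m := by
  obtain ⟨h1, h2, h3⟩ := hf.input
  have hmt : m + 1 < t := by
    by_contra hlt
    rcases Nat.lt_or_ge t (m + 1) with h4 | h4
    · have := h.after_top ht h4 h1
      omega
    · obtain rfl : t = m + 1 := by omega
      omega
  -- Backwards from position `m`, which precedes the top and is not in state `2`: the predecessors
  -- of states `0` and `1` are again such states.
  have hlow : ∀ k, k ≤ m → (g (m - k)).1 ≤ 1 := by
    intro k
    induction k with
    | zero =>
      intro _
      have := (h.shape htn (by omega)).2.2 m (by omega)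
      simp only [Nat.sub_zero]
      omega
    | succ k ih =>
      intro hk
      have hm := (h.step (m - (k + 1)) (by omega)).spec.1
      rw [show m - (k + 1) + 1 = m - k by omega] at hm
      have := ih (by omega)
      omega
  have hone : ∀ j, 1 ≤ j → j ≤ m → (g j).1 = 1 := by
    intro j hj hjm
    have h5 := hlow (m - j) (by omega)
    rw [show m - (m - j) = j by omega] at h5
    have := (h.before_top ht htn hj (by omega)).1
    omega
  have htwo : ∀ j, m + 1 ≤ j → j < t → (g j).1 = 2 := by
    intro j hj
    induction j, hj using Nat.le_induction with
    | base => exact fun _ => h2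
    | succ j hj ih =>
      intro hjt
      have hm := (h.step j (by omega)).spec
      have := ih (by omega)
      have := (h.before_top ht htn (j := j + 1) (by omega) hjt).1
      omega
  have hmark (j : ℕ) (hj : j ≤ t) (i : Instr) (c : ℕ) :
      (g j).1 ∈ marks E i c ↔ (1 ≤ j ∧ j ≤ m) ∧ i = .inc ∧ c = 0 := by
    have h3 : (g j).1 ≤ 3 := by
      rcases hj.lt_or_eq with hj | rfl
      · have := (h.shape htn (by omega)).2.2 j hj
        omega
      · omega
    rw [mem_marks_of_le_three E h3]
    refine and_congr_left fun _ => ⟨fun h5 => ?_, fun h5 => hone j h5.1 h5.2⟩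
    have h6 : j ≠ 0 := by
      rintro rfl
      simp [h.start] at h5
    refine ⟨by omega, ?_⟩
    by_contra hlt
    rcases hj.lt_or_eq with hj | rfl
    · have := htwo j (by omega) hj
      omega
    · omega
  -- Position `0` has letter `0` and marks nothing, hence `p - 1`.
  have hcount : ∀ p, p ≤ t + 1 → ∀ c, countMarks E g .dec c p = 0 ∧
      countMarks E g .inc c p = if c = 0 then min (p - 1) m else 0 := by
    intro p
    induction p with
    | zero => simp [countMarks]
    | succ p ih =>
      intro hp c
      obtain ⟨h5, h6⟩ := ih (by omega) c
      rw [countMarks_succ, countMarks_succ, h5, h6]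
      simp only [hmark p (by omega)]
      refine ⟨by simp, ?_⟩
      split_ifs <;> simp_all <;> omega
  funext c
  obtain ⟨h5, h6⟩ := hcount (t + 1) le_rfl c
  rw [storeAt, h5, h6, update_apply]
  split_ifs
  · omega
  · rfl

/-- A faithful run that ends in the exit node yields an execution of the control graph. -/
theorem exists_execution (hf : IsFaithful E g n m) (h : IsGraphRun E a b g n)
    (hb : (g n).1 = walkState b) :
    ∃ s', Relation.ReflTransGen (GraphStep E) (a, update (fun _ => 0) 0 m) (b, s') := by
  obtain ⟨t, htn, ht⟩ := h.exists_top le_rfl (hb ▸ four_le_walkState b)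
  -- At a mark state the edge counts as taken, so the node is already its target and the store is
  -- that of the next position.
  have key : ∀ i, t + 1 ≤ i → i ≤ n →
      (∀ s, (g i).1 = walkState s → Relation.ReflTransGen (GraphStep E)
        (a, update (fun _ => 0) 0 m) (s, storeAt E g i)) ∧
      (∀ e ∈ E, (g i).1 = markState e.2 → Relation.ReflTransGen (GraphStep E)
        (a, update (fun _ => 0) 0 m) (e.2.2, storeAt E g (i + 1))) := by
    intro i hi
    induction i, hi using Nat.le_induction with
    | base =>
      intro _
      have hw := (h.step t htn).spec.2.2.1 ht
      refine ⟨fun s hs => ?_, fun e _ he => ?_⟩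
      · rw [hf.storeAt_top h ht htn.le]
        obtain rfl := walkState_inj (hw.symm.trans hs)
        exact .refl
      · exact absurd (hw.symm.trans he) (walkState_ne_markState _ _)
    | succ i hi ih =>
      intro hin
      obtain ⟨ih1, ih2⟩ := ih (by omega)
      have h4 := h.after_top ht hi (by omega)
      have hstore (s : ℕ) (hs : (g i).1 = walkState s) : storeAt E g (i + 1) = storeAt E g i := by
        funext c
        simp only [storeAt, countMarks_succ, hs, walkState_notMem_marks, if_false, add_zero]
      rcases h.step i (by omega) with h' | h' | h' | h' | ⟨s, hs, h1, h2, h3⟩ | ⟨e, he, h1, h2, h3⟩ |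
        ⟨e, he, h1, h2, h3⟩
      · omega
      · omega
      · omega
      · omega
      · refine ⟨fun s' hs' => ?_, fun e _ he => ?_⟩
        · obtain rfl := walkState_inj (h2.symm.trans hs')
          rw [hstore s h1]
          exact ih1 s h1
        · exact absurd (h2.symm.trans he) (walkState_ne_markState _ _)
      · refine ⟨fun s' hs' => ?_, fun e' he' hm => ?_⟩
        · exact absurd (hs'.symm.trans h2) (walkState_ne_markState _ _)
        · rw [← markState_inj (h2.symm.trans hm)]
          refine (ih1 e.1 h1).tail ⟨e.2.1, he, ?_⟩
          rw [← hstore _ h1]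
          exact hf.sem_storeAt h he hin h2
      · refine ⟨fun s' hs' => ?_, fun e _ he => ?_⟩
        · rw [← walkState_inj (h2.symm.trans hs')]
          exact ih2 e he h1
        · exact absurd (h2.symm.trans he) (walkState_ne_markState _ _)
  exact ⟨_, (key n htn le_rfl).1 b hb⟩

end IsFaithful
end Runs

/-! ### Executions are represented by faithful runs -/

/-- A configuration of the automaton together with the numbers of increments and decrements of each
counter that have been marked before. -/
structure AnnotatedConfig : Type where
  config : ℕ × ℕ
  incs : ℕ → ℕ
  decs : ℕ → ℕ

section Construction
variable (E : List (ℕ × CounterOp × ℕ)) (a b N m : ℕ)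

/-- Increments and decrements are marked at the values `0, 1, 2, …` in this order, zero tests when all increments
have been matched, below the top value `N` and with `m` initial increments of counter `0`. -/
structure IsRanked (x : AnnotatedConfig) : Prop where
  inc : ∀ c, x.config.1 ∈ marks E .inc c → x.config.2 = x.incs c
  dec : ∀ c, x.config.1 ∈ marks E .dec c → x.config.2 = x.decs c ∧ x.decs c < x.incs c
  ifzero : ∀ c, x.config.1 ∈ marks E .ifzero c → x.incs c = x.decs c
  below : 4 ≤ x.config.1 → x.config.2 < N
  top : x.config.1 = 3 → x.config.2 = N
  one : x.config.1 = 1 → x.config.2 < m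
  two : x.config.1 = 2 → m ≤ x.config.2

/-- A step of the automaton that updates the numbers of marks and reaches a ranked configuration. -/
structure RankedStep (x y : AnnotatedConfig) : Prop where
  move : GraphMove E a b x.config y.config
  ranked : IsRanked E N m y
  incs : ∀ c, y.incs c = x.incs c + if x.config.1 ∈ marks E .inc c then 1 else 0
  decs : ∀ c, y.decs c = x.decs c + if x.config.1 ∈ marks E .dec c then 1 else 0

/-- The initial configuration. -/
def AnnotatedConfig.start : AnnotatedConfig := ⟨(0, 0), fun _ => 0, fun _ => 0⟩

theorem isRanked_start : IsRanked E N m .start := by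
  constructor <;> simp [AnnotatedConfig.start, mem_marks_of_le_three]

variable {E a b N m}

theorem exists_sequence_of_reflTransGen {α : Type} {r : α → α → Prop} {x y : α}
    (h : Relation.ReflTransGen r x y) :
    ∃ (f : ℕ → α) (n : ℕ), f 0 = x ∧ f n = y ∧ ∀ i < n, r (f i) (f (i + 1)) := by
  induction h with
  | refl => exact ⟨fun _ => x, 0, rfl, rfl, by simp⟩
  | @tail y z _ hyz ih =>
    obtain ⟨f, n, h1, h2, h3⟩ := ih
    refine ⟨fun i => if i ≤ n then f i else z, n + 1, by simpa using h1, by simp, fun i hi => ?_⟩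
    beta_reduce
    rcases Nat.lt_succ_iff_lt_or_eq.1 hi with hi | rfl
    · rw [if_pos hi.le, if_pos (Nat.succ_le_of_lt hi)]
      exact h3 i hi
    · rw [if_pos le_rfl, if_neg (by omega), h2]
      exact hyz

theorem mono_of_step {u : ℕ → ℕ} {n : ℕ} {P : ℕ → Prop} [DecidablePred P]
    (h : ∀ i < n, u (i + 1) = u i + if P i then 1 else 0) {i j : ℕ} (hij : i ≤ j) (hj : j ≤ n) :
    u i ≤ u j := by
  induction j, hij using Nat.le_induction with
  | base => exact le_rfl
  | succ j _ ih =>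
    have := ih (by omega)
    have := h j (by omega)
    omega

theorem strict_of_step {u : ℕ → ℕ} {n : ℕ} {P : ℕ → Prop} [DecidablePred P]
    (h : ∀ i < n, u (i + 1) = u i + if P i then 1 else 0) {i j : ℕ} (hij : i < j) (hj : j ≤ n)
    (hi : P i) : u i < u j := by
  have h1 := h i (by omega)
  rw [if_pos hi] at h1
  have := mono_of_step h (i := i + 1) hij hj
  omega

/-- A count that starts at `0` and grows by at most one passes every smaller value, and it leaves
that value at a position satisfying `P`. -/
theorem exists_of_step {u : ℕ → ℕ} {n : ℕ} {P : ℕ → Prop} [DecidablePred P] (h0 : u 0 = 0)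
    (h : ∀ i < n, u (i + 1) = u i + if P i then 1 else 0) {j r : ℕ} (hj : j ≤ n) (hr : r < u j) :
    ∃ i < j, P i ∧ u i = r := by
  induction j with
  | zero => omega
  | succ j ih =>
    have h1 := h j (by omega)
    by_cases hlt : r < u j
    · obtain ⟨i, hi, h2⟩ := ih (by omega) hlt
      exact ⟨i, by omega, h2⟩
    · by_cases hP : P j
      · rw [if_pos hP] at h1
        exact ⟨j, by omega, hP, by omega⟩
      · rw [if_neg hP] at h1
        omega

/-- Since marks sit at their own rank, distinctness is strict growth of the counts, and the
decrement of rank `r` is matched with the increment of rank `r`, which is earlier because decrements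
never outnumber increments. -/
theorem isFaithful_of_rankedSteps {f : ℕ → AnnotatedConfig} {n : ℕ} (h0 : f 0 = .start)
    (hstep : ∀ i < n, RankedStep E a b N m (f i) (f (i + 1))) (hN : m + 1 ≤ N)
    (hn : 4 ≤ (f n).config.1) :
    IsGraphRun E a b (fun i => (f i).config) n ∧ IsFaithful E (fun i => (f i).config) n m := by
  have hrun : IsGraphRun E a b (fun i => (f i).config) n :=
    ⟨by simp [h0, AnnotatedConfig.start], fun i hi => (hstep i hi).move⟩
  refine ⟨hrun, ?_⟩
  have hrank : ∀ i ≤ n, IsRanked E N m (f i) := by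
    intro i hi
    rcases i with _ | i
    · rw [h0]
      exact isRanked_start E N m
    · exact (hstep i hi).ranked
  have hI (c : ℕ) : ∀ i < n, (f (i + 1)).incs c =
      (f i).incs c + if (f i).config.1 ∈ marks E .inc c then 1 else 0 :=
    fun i hi => (hstep i hi).incs c
  have hD (c : ℕ) : ∀ i < n, (f (i + 1)).decs c =
      (f i).decs c + if (f i).config.1 ∈ marks E .dec c then 1 else 0 :=
    fun i hi => (hstep i hi).decs c
  have hI0 (c : ℕ) : (f 0).incs c = 0 := by simp [h0, AnnotatedConfig.start]
  have hD0 (c : ℕ) : (f 0).decs c = 0 := by simp [h0, AnnotatedConfig.start]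
  obtain ⟨t, htn, ht⟩ := hrun.exists_top le_rfl hn
  have htN : t = N + 1 := by
    have h1 := (hrank t htn.le).top ht
    have h2 := hrun.top_val ht htn.le
    omega
  refine ⟨?_, ?_, ?_, ?_, ?_, ?_, ?_⟩
  · intro c i j hij hj hi' hj'
    have h1 := (hrank i (by omega)).inc c hi'
    have h2 := (hrank j hj).inc c hj'
    have := strict_of_step (u := fun i => (f i).incs c) (hI c) hij hj hi'
    omega
  · intro c i j hij hj hi' hj'
    have h1 := (hrank i (by omega)).dec c hi'
    have h2 := (hrank j hj).dec c hj'
    have := strict_of_step (u := fun i => (f i).decs c) (hD c) hij hj hi'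
    omega
  -- The matching increment `j` cannot precede the climbing position `i`: it would lie in the climb
  -- too, where equal values mean equal positions.
  · intro c i k hik hk hi' hk' hval
    obtain ⟨h1, h2⟩ := (hrank k hk).dec c hk'
    obtain ⟨j, hjk, hj, hr⟩ := exists_of_step (u := fun i => (f i).incs c) (hI0 c) (hI c) hk h2
    have h3 := (hrank j (by omega)).inc c hj
    refine ⟨j, ?_, hj, by omega, k, by omega, hk, hk', hval⟩
    simp only [List.mem_cons, List.not_mem_nil, or_false] at hi'
    have hit : i < t := by
      by_contra hlt
      rcases (not_lt.1 hlt).lt_or_eq with hlt | rfl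
      · have := hrun.after_top ht hlt (by omega)
        omega
      · omega
    have hi0 : i ≠ 0 := by
      rintro rfl
      simp [h0, AnnotatedConfig.start] at hi'
    have hj0 : j ≠ 0 := by
      rintro rfl
      simp [h0, AnnotatedConfig.start, mem_marks_of_le_three] at hj
    have h4 := (hrun.before_top ht htn.le (j := i) (by omega) hit).2
    by_contra hlt
    have h5 := (hrun.before_top ht htn.le (j := j) (by omega) (by omega)).2
    omega
  -- At the test the counts agree, so the rank of the increment at `i` is also the rank of a
  -- decrement `j`. If `j` preceded `i`, its rank would be below the number of increments before
  -- `i`, which is that same rank.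
  · intro c i k hik hk hi' hk'
    have hne : i ≠ k := by
      rintro rfl
      exact absurd (eq_of_mem_marks E hi' hk').1 (by simp)
    have h1 := (hrank k hk).ifzero c hk'
    have h2 := strict_of_step (u := fun i => (f i).incs c) (hI c) (by omega : i < k) hk hi'
    obtain ⟨j, hjk, hj, hr⟩ := exists_of_step (u := fun i => (f i).decs c) (hD0 c) (hD c) hk
      (h1 ▸ h2)
    have h3 := (hrank j (by omega)).dec c hj
    have h4 := (hrank i (by omega)).inc c hi'
    refine ⟨j, ?_, by omega, hj, by omega⟩
    by_contra hlt
    have := mono_of_step (u := fun i => (f i).incs c) (hI c) (i := j) (j := i) (by omega) (by omega)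
    omega
  -- All increments before the test are used up, so a decrement after the test has a larger rank
  -- than the increment at `i`.
  · intro c i k j hik hkj hj hi' hk' hj' hval
    have hne : i ≠ k := by
      rintro rfl
      exact absurd (eq_of_mem_marks E hi' hk').1 (by simp)
    have h1 := (hrank k (by omega)).ifzero c hk'
    have h2 := strict_of_step (u := fun i => (f i).incs c) (hI c) (by omega : i < k) (by omega) hi'
    have h3 := mono_of_step (u := fun i => (f i).decs c) (hD c) hkj hj
    have h4 := (hrank i (by omega)).inc c hi'
    have h5 := (hrank j hj).dec c hj'
    omega
  · intro i j hij hj hi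
    have h1 := (hrank i (by omega)).top hi
    have h2 := (hrank j hj).below (hrun.after_top hi hij hj)
    omega
  -- Position `m + 1` has value `m`, too large for state `1`; position `m`, if positive, has value
  -- `m - 1`, too small for state `2`.
  · have h1 := hrun.before_top ht htn.le (j := m + 1) (by omega) (by omega)
    refine ⟨by omega, ?_, fun h2 => ?_⟩
    · refine h1.1.resolve_left fun h2 => ?_
      have := (hrank (m + 1) (by omega)).one h2
      omega
    · have h3 := (hrank m (by omega)).two h2
      have hm : m ≠ 0 := by
        rintro rfl
        simp [h0, AnnotatedConfig.start] at h2
      have h4 := (hrun.before_top ht htn.le (j := m) (by omega) (by omega)).2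
      omega

theorem isRanked_walk {s x : ℕ} (hx : x < N) (I D : ℕ → ℕ) :
    IsRanked E N m ⟨(walkState s, x), I, D⟩ := by
  have := four_le_walkState s
  constructor <;> simp [walkState_notMem_marks, hx] <;> omega

theorem rankedStep_walk {s x y : ℕ} (hs : s ∈ graphNodes E a b) (hy : y < N)
    (hxy : y = x + 1 ∨ x = y + 1) (I D : ℕ → ℕ) :
    RankedStep E a b N m ⟨(walkState s, x), I, D⟩ ⟨(walkState s, y), I, D⟩ where
  move := .inr (.inr (.inr (.inr (.inl ⟨s, hs, rfl, rfl, hxy⟩))))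
  ranked := isRanked_walk hy I D
  incs c := by simp [walkState_notMem_marks]
  decs c := by simp [walkState_notMem_marks]

theorem reflTransGen_walk {s x y : ℕ} (hs : s ∈ graphNodes E a b) (hx : x < N) (hy : y < N)
    (I D : ℕ → ℕ) : Relation.ReflTransGen (RankedStep E a b N m) ⟨(walkState s, x), I, D⟩
      ⟨(walkState s, y), I, D⟩ := by
  rcases le_total x y with hxy | hxy
  · induction y, hxy using Nat.le_induction with
    | base => exact .refl
    | succ y _ ih => exact (ih (by omega)).tail (rankedStep_walk hs hy (.inl rfl) I D)
  · induction x, hxy using Nat.le_induction with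
    | base => exact .refl
    | succ x _ ih => exact .head (rankedStep_walk hs (by omega) (.inr rfl) I D) (ih (by omega))

/-- Values `0, …, m - 1` are visited in state `1`, values `m, …, N - 1` in state `2`, and `N` in
state `3`; the `m` visits in state `1` are the annotated increments. -/
theorem reflTransGen_climb (hN : m + 1 ≤ N) :
    Relation.ReflTransGen (RankedStep E a b N m) .start
      ⟨(walkState a, N - 1), update (fun _ => 0) 0 m, fun _ => 0⟩ := by
  have hup : ∀ k, update (fun _ => 0) 0 (k + 1) =
      fun c => update (fun _ : ℕ => 0) 0 k c + if c = 0 then 1 else 0 := by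
    intro k
    funext c
    by_cases hc : c = 0 <;> simp [hc]
  have hr1 (k : ℕ) (hk : k < m) :
      IsRanked E N m ⟨(1, k), update (fun _ => 0) 0 k, fun _ => 0⟩ := by
    constructor <;> simp [mem_marks_of_le_three, hk]
  have hr2 (k : ℕ) (hk : m ≤ k) :
      IsRanked E N m ⟨(2, k), update (fun _ => 0) 0 m, fun _ => 0⟩ := by
    constructor <;> simp [mem_marks_of_le_three, hk]
  have hr3 : IsRanked E N m ⟨(3, N), update (fun _ => 0) 0 m, fun _ => 0⟩ := by
    constructor <;> simp [mem_marks_of_le_three]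
  have h1 : ∀ k, k < m → Relation.ReflTransGen (RankedStep E a b N m) .start
      ⟨(1, k), update (fun _ => 0) 0 k, fun _ => 0⟩ := by
    intro k
    induction k with
    | zero =>
      intro hk
      refine .single ⟨.inl (by simp [AnnotatedConfig.start]), hr1 0 hk, fun c => ?_, fun c => ?_⟩
      · simp [AnnotatedConfig.start, mem_marks_of_le_three]
      · simp [AnnotatedConfig.start, mem_marks_of_le_three]
    | succ k ih =>
      intro hk
      refine (ih (by omega)).tail ⟨.inr (.inl (by simp)), hr1 _ hk, fun c => ?_, fun c => ?_⟩
      · simp only [hup, mem_marks_of_le_three, Nat.one_le_ofNat, true_and]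
      · simp [mem_marks_of_le_three]
  have h2 : Relation.ReflTransGen (RankedStep E a b N m) .start
      ⟨(2, m), update (fun _ => 0) 0 m, fun _ => 0⟩ := by
    rcases m with _ | m
    · refine .single ⟨.inl (by simp [AnnotatedConfig.start]), hr2 _ le_rfl, fun c => ?_, fun c => ?_⟩
      · simp [AnnotatedConfig.start, mem_marks_of_le_three]
      · simp [AnnotatedConfig.start, mem_marks_of_le_three]
    · refine (h1 m (by omega)).tail
        ⟨.inr (.inl (by simp)), hr2 _ le_rfl, fun c => ?_, fun c => ?_⟩
      · simp only [hup, mem_marks_of_le_three, Nat.one_le_ofNat, true_and]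
      · simp [mem_marks_of_le_three]
  have h3 : ∀ k, m ≤ k → k < N → Relation.ReflTransGen (RankedStep E a b N m) .start
      ⟨(2, k), update (fun _ => 0) 0 m, fun _ => 0⟩ := by
    intro k hk
    induction k, hk using Nat.le_induction with
    | base => exact fun _ => h2
    | succ k hk ih =>
      intro hkN
      refine (ih (by omega)).tail
        ⟨.inr (.inr (.inl (by simp))), hr2 _ (by omega), fun c => ?_, fun c => ?_⟩
      · simp [mem_marks_of_le_three]
      · simp [mem_marks_of_le_three]
  have h4 : Relation.ReflTransGen (RankedStep E a b N m) .start
      ⟨(3, N), update (fun _ => 0) 0 m, fun _ => 0⟩ := by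
    refine (h3 (N - 1) (by omega) (by omega)).tail
      ⟨.inr (.inr (.inl ⟨rfl, .inr rfl, by simp only; omega⟩)), hr3, fun c => ?_, fun c => ?_⟩
    · simp [mem_marks_of_le_three]
    · simp [mem_marks_of_le_three]
  refine h4.tail ⟨.inr (.inr (.inr (.inl ⟨rfl, rfl, by simp only; omega⟩))),
    isRanked_walk (by omega) _ _, fun c => ?_, fun c => ?_⟩
  · simp [mem_marks_of_le_three]
  · simp [mem_marks_of_le_three]

/-- An edge of the control graph is simulated by a visit to a suitable counter value. -/
theorem reflTransGen_edge {e : ℕ × CounterOp × ℕ} (he : e ∈ E) {s s' I D : ℕ → ℕ}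
    (hs : ∀ c, s c + D c = I c) (hsem : e.2.1.Sem s s') :
    ∃ I' D' : ℕ → ℕ, (∀ c, s' c + D' c = I' c) ∧ ∃ N₀, ∀ N, N₀ ≤ N →
      Relation.ReflTransGen (RankedStep E a b N m) ⟨(walkState e.1, N - 1), I, D⟩
        ⟨(walkState e.2.2, N - 1), I', D'⟩ := by
  let I' : ℕ → ℕ := fun c => I c + if e.2.1 = some (.inc, c) then 1 else 0
  let D' : ℕ → ℕ := fun c => D c + if e.2.1 = some (.dec, c) then 1 else 0
  -- `v` is the value at which the operation is marked: the rank of the increment or decrement, and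
  -- arbitrary otherwise.
  suffices h : (∀ c, s' c + D' c = I' c) ∧ ∃ v, (∀ c, e.2.1 = some (.inc, c) → v = I c) ∧
      (∀ c, e.2.1 = some (.dec, c) → v = D c ∧ D c < I c) ∧
      (∀ c, e.2.1 = some (.ifzero, c) → I c = D c) by
    obtain ⟨h1, v, h2, h3, h4⟩ := h
    -- The mark state is entered by a decrement from `v + 1`, which must itself lie below the top.
    refine ⟨I', D', h1, v + 2, fun N hN => ?_⟩
    have h5 : RankedStep E a b N m ⟨(walkState e.1, v + 1), I, D⟩ ⟨(markState e.2, v), I, D⟩ := by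
      have := four_le_markState e.2
      refine ⟨.inr (.inr (.inr (.inr (.inr (.inl ⟨e, he, rfl, rfl, rfl⟩))))),
        ⟨?_, ?_, ?_, ?_, ?_, ?_, ?_⟩, ?_, ?_⟩ <;>
        simp only [markState_mem_marks_iff E he, walkState_notMem_marks, if_false, add_zero,
          implies_true]
      · exact h2
      · exact h3
      · exact h4
      all_goals omega
    have h6 : RankedStep E a b N m ⟨(markState e.2, v), I, D⟩
        ⟨(walkState e.2.2, v + 1), I', D'⟩ := by
      refine ⟨.inr (.inr (.inr (.inr (.inr (.inr ⟨e, he, rfl, rfl, rfl⟩))))),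
        isRanked_walk (by omega) _ _, ?_, ?_⟩ <;> intro c <;>
        simp only [markState_mem_marks_iff E he, I', D']
    exact (reflTransGen_walk (source_mem_graphNodes E a b he) (by omega) (by omega) I D).trans
      (.head h5 (.head h6
        (reflTransGen_walk (target_mem_graphNodes E a b he) (by omega) (by omega) I' D')))
  match ho : e.2.1, hsem with
  | none, hsem =>
    obtain rfl : s' = s := hsem
    exact ⟨fun c => by simp [I', D', ho, hs], 0, by simp⟩
  | some (.inc, c), hsem =>
    obtain rfl : s' = update s c (s c + 1) := hsem
    refine ⟨fun c' => ?_, I c, by simp⟩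
    have := hs c'
    simp only [I', D', ho, update_apply, Option.some.injEq, Prod.mk.injEq, true_and, reduceCtorEq,
      false_and, if_false, eq_comm (a := c)]
    split_ifs with h
    · subst h
      omega
    · omega
  | some (.dec, c), hsem =>
    obtain ⟨h0, rfl⟩ : s c ≠ 0 ∧ s' = update s c (s c - 1) := hsem
    refine ⟨fun c' => ?_, D c, by simp, fun c' hc' => ?_, by simp⟩
    · have := hs c'
      simp only [I', D', ho, update_apply, Option.some.injEq, Prod.mk.injEq, true_and, reduceCtorEq,
        false_and, if_false, eq_comm (a := c)]
      split_ifs with h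
      · subst h
        omega
      · omega
    · simp only [Option.some.injEq, Prod.mk.injEq, true_and] at hc'
      subst hc'
      have := hs c
      exact ⟨rfl, by omega⟩
  | some (.ifzero, c), hsem =>
    obtain ⟨h0, rfl⟩ : s c = 0 ∧ s' = s := hsem
    refine ⟨fun c' => by simp [I', D', ho, hs], 0, by simp, by simp, fun c' hc' => ?_⟩
    simp only [Option.some.injEq, Prod.mk.injEq, true_and] at hc'
    subst hc'
    have := hs c
    omega

/-- An execution of the control graph yields a faithful run that ends in the exit node. -/
theorem exists_faithful_run {s : ℕ → ℕ}
    (h : Relation.ReflTransGen (GraphStep E) (a, update (fun _ => 0) 0 m) (b, s)) :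
    ∃ g n, IsGraphRun E a b g n ∧ IsFaithful E g n m ∧ (g n).1 = walkState b := by
  -- The top is fixed during the climb, before the ranks needed later are known; so the claim is
  -- carried for all sufficiently large `N`, and the bounds are combined by `max`.
  have key : ∀ y, Relation.ReflTransGen (GraphStep E) (a, update (fun _ => 0) 0 m) y →
      ∃ I D : ℕ → ℕ, (∀ c, y.2 c + D c = I c) ∧ ∃ N₀, ∀ N, N₀ ≤ N →
        Relation.ReflTransGen (RankedStep E a b N m) .start ⟨(walkState y.1, N - 1), I, D⟩ := by
    intro y hy
    induction hy with
    | refl =>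
      exact ⟨_, fun _ => 0, fun _ => rfl, m + 1, fun N hN => reflTransGen_climb hN⟩
    | @tail y z _ hyz ih =>
      obtain ⟨I, D, h1, N₀, h2⟩ := ih
      obtain ⟨o, h3, h4⟩ := hyz
      obtain ⟨I', D', h5, N₁, h6⟩ := reflTransGen_edge (a := a) (b := b) (m := m) h3 h1 h4
      exact ⟨I', D', h5, max N₀ N₁, fun N hN => (h2 N (by omega)).trans (h6 N (by omega))⟩
  obtain ⟨I, D, -, N₀, hN⟩ := key _ h
  obtain ⟨f, n, h0, hn, hstep⟩ :=
    exists_sequence_of_reflTransGen (hN (max N₀ (m + 1)) (by omega))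
  have hb : (f n).config.1 = walkState b := by rw [hn]
  obtain ⟨h1, h2⟩ := isFaithful_of_rankedSteps h0 hstep (by omega) (hb ▸ four_le_walkState b)
  exact ⟨_, n, h1, h2, hb⟩

end Construction

/-! ### Completeness -/

/-- The sentence for the input `m`. -/
def graphSentence (E : List (ℕ × CounterOp × ℕ)) (m : ℕ) : Formula ℕ :=
  .and (graphFormula E) (.entersAt [2] m)

theorem exists_accepting_run_iff (E : List (ℕ × CounterOp × ℕ)) (a b m : ℕ) :
    (∃ ρ : (graphAutomaton E a b).FiniteRun, ρ.Accepting ∧ ρ.toDataWord.Models (graphSentence E m)) ↔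
      ∃ s', Relation.ReflTransGen (GraphStep E) (a, update (fun _ => 0) 0 m) (b, s') := by
  constructor
  · rintro ⟨⟨n, config, start, step⟩, hacc, hmod⟩
    -- The run is extended to all of `ℕ`, with irrelevant values beyond its end, so that its data
    -- word becomes `wordOf g n` by definition.
    obtain ⟨g, rfl⟩ : ∃ g : ℕ → ℕ × ℕ, config = fun i : Fin (n + 1) => g i :=
      ⟨fun i => if h : i < n + 1 then config ⟨i, h⟩ else (0, 0), by
        funext i
        simp [Nat.lt_succ_iff.1 i.2]⟩
    have hf := (models_wordOf_iff E g n m).1 hmod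
    refine hf.exists_execution ⟨start, fun i hi => ?_⟩ (List.mem_singleton.1 hacc)
    exact (step_graphAutomaton_iff E a b _ _).1 (step ⟨i, hi⟩)
  · rintro ⟨s', h⟩
    obtain ⟨g, n, h1, h2, h3⟩ := exists_faithful_run h
    exact ⟨⟨n, fun i => g i, h1.start,
      fun i => (step_graphAutomaton_iff E a b _ _).2 (h1.step i i.2)⟩,
      List.mem_singleton.2 h3, (models_wordOf_iff E g n m).2 h2⟩

theorem Formula.fits_anyOf {states : List ℕ} {B l : List ℕ} (h0 : 0 ∈ states) (hl : l ⊆ states) :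
    (anyOf l).Fits true states B := by
  rw [anyOf, Fits]
  induction l with
  | nil => exact ⟨h0, h0⟩
  | cons q l ih =>
    exact ⟨hl List.mem_cons_self, ih fun x hx => hl (List.mem_cons_of_mem _ hx)⟩

theorem Formula.fits_iterate_X {states B : List ℕ} {φ : Formula ℕ} (h : φ.Fits true states B)
    (k : ℕ) : (X^[k] φ).Fits true states B := by
  induction k with
  | zero => exact h
  | succ k ih => rwa [Function.iterate_succ_apply']

theorem fits_graphSentence (E : List (ℕ × CounterOp × ℕ)) (a b m : ℕ) :
    (graphSentence E m).Fits true (graphAutomaton E a b).states [] := by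
  have hn (q : ℕ) (hq : q ≤ 3) : q ∈ (graphAutomaton E a b).states :=
    (mem_states_graphAutomaton E a b _).2 (.inl hq)
  have hany {B l : List ℕ} (hl : l ⊆ (graphAutomaton E a b).states) :
      (Formula.anyOf l).Fits true (graphAutomaton E a b).states B :=
    Formula.fits_anyOf (hn 0 (by omega)) hl
  have hm {B : List ℕ} (i c) := hany (B := B) (marks_subset_states E a b i c)
  have h12 {B : List ℕ} := hany (B := B) (l := [1, 2]) (by simp [hn])
  have h2 {B : List ℕ} := hany (B := B) (l := [2]) (by simp [hn])
  have h3 {B : List ℕ} := hany (B := B) (l := [3]) (by simp [hn])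
  have hr : PNat.natPred 1 = 0 := rfl
  refine ⟨?_, Formula.fits_iterate_X h2 _, Formula.fits_iterate_X (φ := .neg (.anyOf [2])) h2 _⟩
  rw [graphFormula]
  induction graphCounters E with
  | nil => simp [Formula.notRepeated, Formula.Fits, h3, hr]
  | cons c l ih =>
    refine ⟨?_, ih⟩
    simp [counterFormula, Formula.distinct, Formula.precededBy, Formula.eventuallyUsed,
      Formula.neverUsedAfter, Formula.Fits, hm, h12, hr]

theorem finitaryMCRestricted_graphSentence_iff (E : List (ℕ × CounterOp × ℕ)) (a b m : ℕ) :
    FinitaryMCRestricted 1 {TemporalOp.X, TemporalOp.F} (graphAutomaton E a b, graphSentence E m) ↔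
      ∃ s', Relation.ReflTransGen (GraphStep E) (a, update (fun _ => 0) 0 m) (b, s') := by
  obtain ⟨h1, h2⟩ := (isInstance_and_iff true (graphAutomaton E a b, graphSentence E m)).2
    ⟨wellFormed_graphAutomaton E a b, fits_graphSentence E a b m⟩
  rw [← exists_accepting_run_iff]
  exact ⟨fun h => h.1.2, fun h => ⟨⟨h1, h⟩, h2 rfl⟩⟩

theorem finitaryMC_graphSentence_iff (E : List (ℕ × CounterOp × ℕ)) (a b m : ℕ) :
    FinitaryMC (graphAutomaton E a b, graphSentence E m) ↔
      ∃ s', Relation.ReflTransGen (GraphStep E) (a, update (fun _ => 0) 0 m) (b, s') := by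
  have h1 := ((isInstance_and_iff true (graphAutomaton E a b, graphSentence E m)).2
    ⟨wellFormed_graphAutomaton E a b, fits_graphSentence E a b m⟩).1
  rw [← exists_accepting_run_iff]
  exact ⟨fun h => h.2, fun h => ⟨h1, h⟩⟩

/-- Only the two iterated `X` depend on the input, and on codes `X` is the map `c ↦ 8 * c + 4`. -/
theorem computable_graphSentence (E : List (ℕ × CounterOp × ℕ)) : Computable (graphSentence E) := by
  have hofCode : Primrec Formula.ofCode := Primrec.of_equiv_symm (e := Formula.equivNat)
  have hiter (φ : Formula ℕ) : Primrec fun m : ℕ => (Formula.X^[m] φ).toCode := by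
    have h : Primrec fun m : ℕ => (fun c => 8 * c + 4)^[m] φ.toCode :=
      Primrec.nat_iterate Primrec.id (Primrec.const _)
        (Primrec.nat_add.comp (Primrec.nat_mul.comp (Primrec.const 8) Primrec.snd)
          (Primrec.const 4)).to₂
    refine h.of_eq fun m => ?_
    induction m with
    | zero => rfl
    | succ m ih => rw [Function.iterate_succ_apply', Function.iterate_succ_apply', ih, Formula.toCode]
  have hand {f g : ℕ → ℕ} (hf : Primrec f) (hg : Primrec g) :
      Primrec fun m => 8 * Nat.pair (f m) (g m) + 3 :=
    Primrec.nat_add.comp (Primrec.nat_mul.comp (Primrec.const 8) (Primrec₂.natPair.comp hf hg))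
      (Primrec.const 3)
  have h : Primrec fun m => (graphSentence E m).toCode :=
    hand (Primrec.const _) (hand ((hiter _).comp Primrec.succ) (hiter _))
  exact ((hofCode.comp h).of_eq fun m => Formula.ofCode_toCode _).to_comp

theorem exists_reduction {q : ℕ → Prop} (hq : REPred q) :
    ∃ f : ℕ → OneCounterAutomaton × Formula ℕ, Computable f ∧ (∀ n, q n ↔ FinitaryMC (f n)) ∧
      ∀ n, q n ↔ FinitaryMCRestricted 1 {TemporalOp.X, TemporalOp.F} (f n) := by
  obtain ⟨E, a, b, h⟩ := exists_graph_of_rePred hq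
  refine ⟨fun n => (graphAutomaton E a b, graphSentence E n),
    (Computable.const _).pair (computable_graphSentence E), fun n => ?_, fun n => ?_⟩
  · rw [h, finitaryMC_graphSentence_iff]
  · rw [h, finitaryMCRestricted_graphSentence_iff]

end FreezeMC

theorem theorem5 :
    FreezeMC.SigmaZeroOneComplete FreezeMC.FinitaryMC ∧
      FreezeMC.SigmaZeroOneComplete
        (FreezeMC.FinitaryMCRestricted 1 {FreezeMC.TemporalOp.X, FreezeMC.TemporalOp.F}) := by
  refine ⟨⟨FreezeMC.rePred_finitaryMC, fun q hq => ?_⟩,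
    FreezeMC.rePred_finitaryMCRestricted, fun q hq => ?_⟩
  · obtain ⟨f, hf, h, -⟩ := FreezeMC.exists_reduction hq
    exact ⟨f, hf, h⟩
  · obtain ⟨f, hf, -, h⟩ := FreezeMC.exists_reduction hq
    exact ⟨f, hf, h⟩
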